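/- Let $\mathfrak S_n$ carry the strong Bruhat order, i.e. the reflexive transitive closure of the relations $u\lessdot v$ given by $v=(i,j)u$ and $\ell(v)=\ell(u)+1$, where $\ell$ is the length with respect to the simple transpositions. Identify $\sigma\in\mathfrak S_n$ with the point $(\sigma(1),\dots,\sigma(n))\in\mathbb R^n$ and let $\Pi_n=\mathrm{conv}(\mathfrak S_n)$ be the permutahedron. A Bruhat interval polytope (BIP) is a polytope $P_{[u,v]}=\mathrm{conv}\{z\in\mathfrak S_n: u\le z\le v\}$ with $u\le v$. A split of a polytope $P$ is a polytopal subdivision of $P$ without new vertices that has exactly two maximal cells $F_1,F_2$; it is the $H$-split of $P$, for a hyperplane $H\subset\mathbb R^n$, if the affine span of $F_1\cap F_2$ is the intersection of $H$ with the affine span of $P$ and $\{F_1,F_2\}=\{P\cap H^{\le},P\cap H^{\ge}\}$, where $H^{\le}$ and $H^{\ge}$ are the two closed half-spaces bounded by $H$. Theorem. Let $n$ be a natural number. Every split of $\Pi_n$ whose two maximal cells are BIPs is the $H$-split of $\Pi_n$ for a hyperplane $H$ of one of the following types: (T1) $H: x_1+\cdots+x_j=1+2+\cdots+(j-1)+(j+1)=\binom{j+1}{2}+1$,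 where $1\le j\le n-2$; (T2) $H: x_1+\cdots+x_j=n+(n-1)+\cdots+(n-(j-2))+(n-j)$, where $1\le j\le n-2$ (for $j=1$ the right-hand side is $n-1$); (T3) $H: x_i=r$, where $2\le r\le n-1$ and $i\in\{1,n\}$. Conversely, every hyperplane $H$ of type (T1), (T2) or (T3) gives an $H$-split of $\Pi_n$ whose two maximal cells are BIPs. -/

import Mathlib

/-! ### Bruhat order on the symmetric group -/

/-- `IsSimpleTransposition s`: `s` is one of the simple transpositions `(i, i+1)`. -/
def IsSimpleTransposition {n : ℕ} (s : Equiv.Perm (Fin n)) : Prop :=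
  ∃ i j : Fin n, i.val + 1 = j.val ∧ s = Equiv.swap i j

/-- The length of a permutation: the least number of simple transpositions whose product is `u`.
The set below is never empty, since the simple transpositions generate the symmetric group. -/
noncomputable def permLength {n : ℕ} (u : Equiv.Perm (Fin n)) : ℕ :=
  sInf {k : ℕ | ∃ w : List (Equiv.Perm (Fin n)),
    (∀ s ∈ w, IsSimpleTransposition s) ∧ w.length = k ∧ w.prod = u}

/-- The covering relation of the (strong) Bruhat order: `v = (i, j) u` and `ℓ(v) = ℓ(u) + 1`. -/
def BruhatCover {n : ℕ} (u v : Equiv.Perm (Fin n)) : Prop :=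
  permLength v = permLength u + 1 ∧ ∃ i j : Fin n, i < j ∧ Equiv.swap i j * u = v

/-- The (strong) Bruhat order, the reflexive transitive closure of the covering relation. -/
def BruhatLE {n : ℕ} (u v : Equiv.Perm (Fin n)) : Prop :=
  Relation.ReflTransGen BruhatCover u v

/-! ### The permutahedron and Bruhat interval polytopes -/

/-- The point `(σ(1), …, σ(n))` of `ℝⁿ`, the one-line notation of `σ` with values in `{1, …, n}`. -/
def permPoint {n : ℕ} (σ : Equiv.Perm (Fin n)) : Fin n → ℝ :=
  fun i => ((σ i).val : ℝ) + 1

/-- The permutahedron `Π_n`. -/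
def permutahedron (n : ℕ) : Set (Fin n → ℝ) :=
  convexHull ℝ (Set.range (permPoint (n := n)))

/-- `F` is a Bruhat interval polytope: the convex hull of the permutations in some Bruhat interval
`[u, v]` with `u ≤ v`. -/
def IsBruhatIntervalPolytope {n : ℕ} (F : Set (Fin n → ℝ)) : Prop :=
  ∃ u v : Equiv.Perm (Fin n), BruhatLE u v ∧
    F = convexHull ℝ (permPoint '' {z | BruhatLE u z ∧ BruhatLE z v})

/-! ### Polytopal subdivisions and splits -/

/-- A polytope: the convex hull of a finite set (the empty polytope is allowed). -/
def IsPolytope {n : ℕ} (C : Set (Fin n → ℝ)) : Prop :=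
  ∃ V : Finset (Fin n → ℝ), C = convexHull ℝ (V : Set (Fin n → ℝ))

/-- `S` is (the set of cells of) a polytopal subdivision of `P` without new vertices: a finite
polytopal complex with union `P`, each of whose vertices is a vertex of `P`.
`IsExposed ℝ C B` says that `B` is a face of the polytope `C`: the empty face, or the set where some
linear functional attains its maximum over `C` (the zero functional gives `C` itself). -/
structure IsPolytopalSubdivision {n : ℕ} (P : Set (Fin n → ℝ)) (S : Set (Set (Fin n → ℝ))) :
    Prop where
  finite : S.Finite
  polytope : ∀ C ∈ S, IsPolytope C
  face_mem : ∀ C ∈ S, ∀ B, IsExposed ℝ C B → B ∈ S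
  inter_face : ∀ C ∈ S, ∀ D ∈ S, IsExposed ℝ C (C ∩ D) ∧ IsExposed ℝ D (C ∩ D)
  cover : ⋃₀ S = P
  no_new_vertices : ∀ x, {x} ∈ S → x ∈ P.extremePoints ℝ

/-- A split of `P` with maximal cells `F₁` and `F₂`: a polytopal subdivision of `P` without new
vertices with exactly two (inclusion-)maximal cells `F₁`, `F₂`. -/
structure IsSplit {n : ℕ} (P : Set (Fin n → ℝ)) (S : Set (Set (Fin n → ℝ)))
    (F₁ F₂ : Set (Fin n → ℝ)) : Prop where
  subdivision : IsPolytopalSubdivision P S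
  ne : F₁ ≠ F₂
  maximal_iff : ∀ F, Maximal (fun C => C ∈ S) F ↔ F = F₁ ∨ F = F₂

/-! ### Hyperplanes -/

/-- The hyperplane `H : ∑ a_i x_i = b` of `ℝⁿ`. -/
def hyperplane {n : ℕ} (a : Fin n → ℝ) (b : ℝ) : Set (Fin n → ℝ) := {x | ∑ i, a i * x i = b}

/-- The closed half-space `H^≤`. -/
def lowerHalf {n : ℕ} (a : Fin n → ℝ) (b : ℝ) : Set (Fin n → ℝ) := {x | ∑ i, a i * x i ≤ b}

/-- The closed half-space `H^≥`. -/
def upperHalf {n : ℕ} (a : Fin n → ℝ) (b : ℝ) : Set (Fin n → ℝ) := {x | b ≤ ∑ i, a i * x i}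

/-- The split `S` of `P` with maximal cells `F₁`, `F₂` is the `H`-split of `P`, for the hyperplane
`H : ∑ a_i x_i = b`: the affine span of `F₁ ∩ F₂` is the hyperplane which `H` cuts out in the
affine span of `P`, and the two cells are `P ∩ H^≤` and `P ∩ H^≥`, in some order. -/
structure IsHyperplaneSplit {n : ℕ} (P : Set (Fin n → ℝ)) (a : Fin n → ℝ) (b : ℝ)
    (S : Set (Set (Fin n → ℝ))) (F₁ F₂ : Set (Fin n → ℝ)) : Prop where
  split : IsSplit P S F₁ F₂
  span_inter : (affineSpan ℝ (F₁ ∩ F₂) : Set (Fin n → ℝ)) =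
    (affineSpan ℝ P : Set (Fin n → ℝ)) ∩ hyperplane a b
  cells : (F₁ = P ∩ lowerHalf a b ∧ F₂ = P ∩ upperHalf a b) ∨
    (F₁ = P ∩ upperHalf a b ∧ F₂ = P ∩ lowerHalf a b)

/-- The coefficient vector of `x_1 + ⋯ + x_j`. -/
def firstSum (n j : ℕ) : Fin n → ℝ := fun i => if i.val < j then 1 else 0

/-- Type (T1): `x_1 + ⋯ + x_j = 1 + 2 + ⋯ + (j-1) + (j+1) = C(j+1, 2) + 1`, `1 ≤ j ≤ n - 2`. -/
def IsTypeT1 (n : ℕ) (a : Fin n → ℝ) (b : ℝ) : Prop :=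
  ∃ j : ℕ, 1 ≤ j ∧ j + 2 ≤ n ∧ a = firstSum n j ∧ b = ((j + 1).choose 2 : ℝ) + 1

/-- Type (T2): `x_1 + ⋯ + x_j = n + (n-1) + ⋯ + (n-(j-2)) + (n-j)`, `1 ≤ j ≤ n - 2`. -/
def IsTypeT2 (n : ℕ) (a : Fin n → ℝ) (b : ℝ) : Prop :=
  ∃ j : ℕ, 1 ≤ j ∧ j + 2 ≤ n ∧ a = firstSum n j ∧
    b = (∑ k ∈ Finset.range (j - 1), ((n : ℝ) - k)) + ((n : ℝ) - j)

/-- Type (T3): `x_i = r` with `2 ≤ r ≤ n - 1` and `i` the first or the last index. -/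
def IsTypeT3 (n : ℕ) (a : Fin n → ℝ) (b : ℝ) : Prop :=
  ∃ (i : Fin n) (r : ℕ), (i.val = 0 ∨ i.val + 1 = n) ∧ 2 ≤ r ∧ r + 1 ≤ n ∧
    a = Pi.single i 1 ∧ b = r

open Equiv Finset

/-! Everything reduces to the prefix sums `prefixSum j`, the values of `x_1 + ⋯ + x_j` at
permutations. They are weakly increasing along the Bruhat order, and if `u ≤ v` have equal prefix
sums, then they have the same set of first `j` entries (`BruhatLE.prefixSum_le`). The pivotal
condition is `PrefixUnique n j b`: the level `b` determines this set.

From a split to a prefix sum: one cell contains the identity, so the cells are `[1, v]` and `[u,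
w₀]`, separated by a functional `h` at a level `c` (`IsSplit.exists_halfSpaces`). Comparing `v` with
its adjacent swaps shows that `h` has weakly decreasing coefficients. Choose `j` where they drop
strictly; subtracting the drop times `x_1 + ⋯ + x_j` keeps them decreasing. Since `u ≤ v` and `h`
takes the value `c` at both, the prefix sum agrees at `u` and `v`. It is thus constant on the whole
section of the permutahedron by `h = c`, and so is a positive multiple of `h` up to a constant.
Permutations on this level all lie above `u`, so they share the prefix set of `u`
(`exists_prefixSum_of_intervals`).

Classification: moving one entry of the prefix set down by one and another up by one keeps the sum.
`PrefixUnique` forbids doing both independently, so any possible down move overlaps any possible up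
move (`PrefixUnique.overlap`). Strictly between the extreme levels this leaves `j = 1`, `j = n - 1`,
minimum plus one and maximum minus one (`PrefixUnique.classification`).

Conversely, a unique prefix makes both sides of the level Bruhat intervals: every permutation on the
lower side climbs to one that is decreasing on both blocks of positions at level `b`, and that
permutation is unique. Complementing values handles the upper side. The cut creates no new vertices
because minimizers of a linear functional are joined by steps changing a prefix sum by at most one
(`exists_minimizer_prefixSum_eq`, used through `mem_convexHull_halfSpace`). The faces of the two
pieces then form the split (`isSplit_gluedFaces`). -/

/-! ### Inversions and the length function -/

/-- The inversions of a permutation. -/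
def inversions {n : ℕ} (u : Perm (Fin n)) : Finset (Fin n × Fin n) :=
  univ.filter fun p => p.1 < p.2 ∧ u p.2 < u p.1

/-- The number of inversions of a permutation. -/
def invNum {n : ℕ} (u : Perm (Fin n)) : ℕ := (inversions u).card

lemma mem_inversions {n : ℕ} {u : Perm (Fin n)} {p : Fin n × Fin n} :
    p ∈ inversions u ↔ p.1 < p.2 ∧ u p.2 < u p.1 := by simp [inversions]

lemma invNum_lt_mul_swap {n : ℕ} {u : Perm (Fin n)} {a b : Fin n} (hab : a < b) (h : u a < u b) :
    invNum u < invNum (u * swap a b) := by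
  have hmem : (a, b) ∈ inversions (u * swap a b) := by
    simp [mem_inversions, hab, h]
  unfold invNum
  rw [← Finset.card_erase_add_one hmem, Nat.lt_succ_iff]
  -- Transport an inversion by the swap of positions, unless this would reverse the order of the
  -- pair, in which case the pair is an inversion already. The new inversion `(a, b)` is never hit.
  refine Finset.card_le_card_of_injOn
    (fun p => if swap a b p.1 < swap a b p.2 then (swap a b p.1, swap a b p.2) else p) ?_ ?_
  · rintro ⟨p, q⟩ hpq
    rw [Finset.mem_coe, mem_inversions] at hpq
    dsimp only at hpq
    obtain ⟨h1, h2⟩ := hpq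
    rw [Finset.mem_coe, Finset.mem_erase, mem_inversions]
    dsimp only
    split_ifs with hs
    · refine ⟨?_, hs, by simpa using h2⟩
      intro he
      rw [Prod.mk.injEq, swap_apply_eq_iff, swap_apply_eq_iff, swap_apply_left,
        swap_apply_right] at he
      rw [he.1, he.2] at h1
      exact lt_asymm h1 hab
    · refine ⟨?_, h1, ?_⟩
      · intro he
        rw [Prod.mk.injEq] at he
        rw [he.1, he.2] at h2
        exact lt_asymm h2 h
      · simp only [Perm.coe_mul, Function.comp_apply]
        simp only [swap_apply_def] at hs ⊢
        split_ifs at hs ⊢ <;> subst_vars <;> omega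
  · rintro ⟨p, q⟩ hpq ⟨p', q'⟩ hpq' he
    rw [Finset.mem_coe, mem_inversions] at hpq hpq'
    dsimp only at he hpq hpq'
    split_ifs at he with h1 h2 h2
    · simpa using he
    · obtain ⟨rfl, rfl⟩ := Prod.mk.inj he
      simp only [swap_apply_self] at h2
      exact absurd hpq.1 h2
    · obtain ⟨rfl, rfl⟩ := Prod.mk.inj he
      simp only [swap_apply_self] at h1
      exact absurd hpq'.1 h1
    · exact he

lemma invNum_mul_swap_lt {n : ℕ} {u : Perm (Fin n)} {a b : Fin n} (hab : a < b) (h : u b < u a) :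
    invNum (u * swap a b) < invNum u := by
  have := invNum_lt_mul_swap (u := u * swap a b) hab (by simpa using h)
  simpa [mul_assoc] using this

/-- An adjacent swap of positions changes the relative order of no pair of positions other than `(a,
b)`, so all other inversions are merely relocated. -/
lemma invNum_mul_swap_le {n : ℕ} (u : Perm (Fin n)) {a b : Fin n} (hab : a.val + 1 = b.val) :
    invNum (u * swap a b) ≤ invNum u + 1 := by
  unfold invNum
  have h := Finset.pred_card_le_card_erase (s := inversions (u * swap a b)) (a := (a, b))
  suffices h' : ((inversions (u * swap a b)).erase (a, b)).card ≤ (inversions u).card by omega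
  refine Finset.card_le_card_of_injOn (fun p => (swap a b p.1, swap a b p.2)) ?_ ?_
  · rintro ⟨p, q⟩ hpq
    rw [Finset.mem_coe, Finset.mem_erase, mem_inversions] at hpq
    rw [Finset.mem_coe, mem_inversions]
    obtain ⟨h0, h1, h2⟩ := hpq
    refine ⟨?_, by simpa using h2⟩
    have h0 : ¬ (p = a ∧ q = b) := fun h => h0 (by rw [h.1, h.2])
    dsimp only at h1 ⊢
    simp only [Fin.ext_iff] at h0
    simp only [swap_apply_def]
    split_ifs <;> subst_vars <;> omega
  · rintro ⟨p, q⟩ _ ⟨p', q'⟩ _ he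
    simpa using he

lemma invNum_inv {n : ℕ} (u : Perm (Fin n)) : invNum u⁻¹ = invNum u := by
  unfold invNum
  refine Finset.card_bij' (fun p _ => (u⁻¹ p.2, u⁻¹ p.1)) (fun p _ => (u p.2, u p.1)) ?_ ?_ ?_ ?_
  all_goals simp +contextual [mem_inversions]

lemma invNum_one (n : ℕ) : invNum (1 : Perm (Fin n)) = 0 := by
  simp only [invNum, Finset.card_eq_zero, Finset.eq_empty_iff_forall_notMem, mem_inversions]
  intro p hp
  exact lt_asymm hp.1 hp.2

lemma strictMono_of_adjacent {n : ℕ} {u : Fin n → Fin n}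
    (h : ∀ a b : Fin n, a.val + 1 = b.val → u a < u b) : StrictMono u := by
  cases n with
  | zero => exact fun a => a.elim0
  | succ n => exact Fin.strictMono_iff_lt_succ.2 fun i => h _ _ (by simp)

lemma eq_one_of_adjacent {n : ℕ} {u : Perm (Fin n)}
    (h : ∀ a b : Fin n, a.val + 1 = b.val → u a < u b) : u = 1 := by
  have hm := strictMono_of_adjacent h
  have : hm.orderIsoOfSurjective u u.surjective = OrderIso.refl _ := Subsingleton.elim _ _
  ext i
  have := congrArg (fun e => (e i).val) this
  simpa using this

lemma exists_adjacent_descent {n : ℕ} {u : Perm (Fin n)} (h : u ≠ 1) :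
    ∃ a b : Fin n, a.val + 1 = b.val ∧ u b < u a := by
  by_contra! hc
  refine h (eq_one_of_adjacent fun a b hab => lt_of_le_of_ne (hc a b hab) ?_)
  intro he
  have := u.injective he
  subst this
  omega

lemma exists_word {n : ℕ} (u : Perm (Fin n)) : ∃ w : List (Perm (Fin n)),
    (∀ s ∈ w, IsSimpleTransposition s) ∧ w.length = invNum u ∧ w.prod = u := by
  induction hk : invNum u using Nat.strong_induction_on generalizing u with
  | _ k ih =>
    by_cases h1 : u = 1
    · refine ⟨[], by simp, ?_, by simp [h1]⟩
      rw [← hk, h1, invNum_one]; rfl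
    obtain ⟨a, b, hab, hd⟩ := exists_adjacent_descent h1
    have hlt : a < b := by rw [Fin.lt_def]; omega
    have h2 := invNum_mul_swap_lt hlt hd
    have h3 := invNum_mul_swap_le (u * swap a b) hab
    rw [mul_assoc, swap_mul_self, mul_one] at h3
    obtain ⟨w, hw, hl, hp⟩ := ih _ (hk ▸ h2) (u * swap a b) rfl
    refine ⟨w ++ [swap a b], ?_, ?_, ?_⟩
    · intro s hs
      rcases List.mem_append.1 hs with hs | hs
      · exact hw s hs
      · rw [List.mem_singleton.1 hs]
        exact ⟨a, b, hab, rfl⟩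
    · rw [List.length_append, List.length_singleton]; omega
    · rw [List.prod_append, hp, List.prod_singleton, mul_assoc, swap_mul_self, mul_one]

lemma invNum_le_length {n : ℕ} (w : List (Perm (Fin n))) (hw : ∀ s ∈ w, IsSimpleTransposition s) :
    invNum w.prod ≤ w.length := by
  induction w with
  | nil => simp [invNum_one]
  | cons s w ih =>
    obtain ⟨i, j, hij, rfl⟩ := hw s (by simp)
    have := ih fun s hs => hw s (by simp [hs])
    have h2 := invNum_mul_swap_le w.prod⁻¹ hij
    rw [← invNum_inv, List.prod_cons, mul_inv_rev, swap_inv]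
    rw [invNum_inv w.prod] at h2
    simp only [List.length_cons]
    omega

lemma permLength_eq_invNum {n : ℕ} (u : Perm (Fin n)) : permLength u = invNum u := by
  refine le_antisymm (Nat.sInf_le (exists_word u)) (le_csInf ⟨_, exists_word u⟩ ?_)
  rintro k ⟨w, hw, rfl, rfl⟩
  exact invNum_le_length w hw

/-! ### Bruhat covers -/

/-- Exchanging two values is exchanging their positions. The smaller value must come first, since
otherwise the inversion number would drop. -/
lemma BruhatCover.exists_swap {n : ℕ} {u v : Perm (Fin n)} (h : BruhatCover u v) :
    ∃ a b : Fin n, a < b ∧ u a < u b ∧ v = u * swap a b := by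
  obtain ⟨hl, i, j, hij, rfl⟩ := h
  rw [permLength_eq_invNum, permLength_eq_invNum] at hl
  have hs : swap i j * u = u * swap (u⁻¹ i) (u⁻¹ j) := by
    rw [mul_swap_eq_swap_mul]; simp
  rw [hs] at hl ⊢
  have hne : u⁻¹ i ≠ u⁻¹ j := fun h => hij.ne (u⁻¹.injective h)
  rcases lt_or_gt_of_ne hne with h | h
  · exact ⟨_, _, h, by simpa using hij, rfl⟩
  · rw [swap_comm] at hl
    have := invNum_mul_swap_lt (u := u) h (by simpa using hij)
    omega

lemma bruhatCover_mul_swap {n : ℕ} {u : Perm (Fin n)} {a b : Fin n} (hab : a.val + 1 = b.val)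
    (h : u a < u b) : BruhatCover u (u * swap a b) := by
  have hlt : a < b := by rw [Fin.lt_def]; omega
  have h1 := invNum_lt_mul_swap hlt h
  have h2 := invNum_mul_swap_le u hab
  exact ⟨by rw [permLength_eq_invNum, permLength_eq_invNum]; omega, u a, u b, h,
    (mul_swap_eq_swap_mul u a b).symm⟩

lemma bruhatCover_swap_mul {n : ℕ} {u : Perm (Fin n)} {k l : Fin n} (hkl : k.val + 1 = l.val)
    (h : u⁻¹ k < u⁻¹ l) : BruhatCover u (swap k l * u) := by
  have hlt : k < l := by rw [Fin.lt_def]; omega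
  have h1 := invNum_lt_mul_swap (u := u⁻¹) hlt h
  have h2 := invNum_mul_swap_le u⁻¹ hkl
  have h3 : u⁻¹ * swap k l = (swap k l * u)⁻¹ := by rw [mul_inv_rev, swap_inv]
  rw [h3, invNum_inv, invNum_inv] at h1 h2
  exact ⟨by rw [permLength_eq_invNum, permLength_eq_invNum]; omega, k, l, hlt, rfl⟩

lemma BruhatLE.refl {n : ℕ} (u : Perm (Fin n)) : BruhatLE u u := Relation.ReflTransGen.refl

lemma BruhatLE.trans {n : ℕ} {u v w : Perm (Fin n)} (h : BruhatLE u v) (h' : BruhatLE v w) :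
    BruhatLE u w := Relation.ReflTransGen.trans h h'

lemma BruhatCover.le {n : ℕ} {u v : Perm (Fin n)} (h : BruhatCover u v) : BruhatLE u v :=
  Relation.ReflTransGen.single h

lemma BruhatLE.invNum_le {n : ℕ} {u v : Perm (Fin n)} (h : BruhatLE u v) :
    invNum u ≤ invNum v := by
  induction h with
  | refl => rfl
  | tail _ h ih =>
    have := h.1
    rw [permLength_eq_invNum, permLength_eq_invNum] at this
    omega

lemma BruhatCover.not_le {n : ℕ} {u v : Perm (Fin n)} (h : BruhatCover u v) : ¬ BruhatLE v u := by
  intro h'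
  have := h.1
  rw [permLength_eq_invNum, permLength_eq_invNum] at this
  have := h'.invNum_le
  omega

lemma bruhatLE_of_descent {n : ℕ} {u : Perm (Fin n)} {a b : Fin n} (hab : a.val + 1 = b.val)
    (h : u b < u a) : BruhatCover (u * swap a b) u := by
  have := bruhatCover_mul_swap (u := u * swap a b) hab (by simpa using h)
  rwa [mul_assoc, swap_mul_self, mul_one] at this

lemma one_bruhatLE {n : ℕ} (u : Perm (Fin n)) : BruhatLE 1 u := by
  induction hk : invNum u using Nat.strong_induction_on generalizing u with
  | _ k ih =>
    by_cases h1 : u = 1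
    · rw [h1]; exact BruhatLE.refl 1
    obtain ⟨a, b, hab, hd⟩ := exists_adjacent_descent h1
    have hc := bruhatLE_of_descent hab hd
    have hlt : a < b := by rw [Fin.lt_def]; omega
    exact (ih _ (hk ▸ invNum_mul_swap_lt hlt hd) _ rfl).trans hc.le

lemma BruhatLE.eq_one {n : ℕ} {u : Perm (Fin n)} (h : BruhatLE u 1) : u = 1 := by
  by_contra h1
  obtain ⟨a, b, hab, hd⟩ := exists_adjacent_descent h1
  have hlt : a < b := by rw [Fin.lt_def]; omega
  have h2 := invNum_mul_swap_lt hlt hd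
  have h3 := h.invNum_le
  rw [invNum_one] at h3
  omega

/-! ### Duality -/

/-- Left multiplication by the longest element. -/
def revPerm (n : ℕ) : Perm (Fin n) := Fin.revPerm

lemma revPerm_mul_apply {n : ℕ} (u : Perm (Fin n)) (i : Fin n) :
    (revPerm n * u) i = Fin.rev (u i) := rfl

lemma revPerm_mul_self (n : ℕ) : revPerm n * revPerm n = 1 := by
  ext i; simp [revPerm]

lemma revPerm_mul_cancel {n : ℕ} (u : Perm (Fin n)) : revPerm n * (revPerm n * u) = u := by
  rw [← mul_assoc, revPerm_mul_self, one_mul]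

lemma invNum_revPerm_mul {n : ℕ} (u : Perm (Fin n)) :
    invNum (revPerm n * u) + invNum u = (univ.filter fun p : Fin n × Fin n => p.1 < p.2).card := by
  rw [add_comm]
  have h1 : inversions u = (univ.filter fun p : Fin n × Fin n => p.1 < p.2).filter
      fun p => u p.2 < u p.1 := by
    ext p; simp [mem_inversions]
  have h2 : inversions (revPerm n * u) = (univ.filter fun p : Fin n × Fin n => p.1 < p.2).filter
      fun p => ¬ u p.2 < u p.1 := by
    ext p
    simp only [mem_inversions, revPerm_mul_apply, Fin.rev_lt_rev, mem_filter, mem_univ, true_and,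
      not_lt, and_congr_right_iff]
    intro hp
    rw [le_iff_lt_or_eq, or_iff_left]
    intro he
    exact hp.ne (u.injective he)
  rw [invNum, invNum, h1, h2, Finset.card_filter_add_card_filter_not]

/-- Complementing values turns inversions into non-inversions, so it reverses the order. All
statements about upper intervals are deduced from lower ones through this. -/
lemma BruhatCover.revPerm_mul {n : ℕ} {u v : Perm (Fin n)} (h : BruhatCover u v) :
    BruhatCover (revPerm n * v) (revPerm n * u) := by
  obtain ⟨a, b, hab, hu, hv⟩ := h.exists_swap
  have hl := h.1
  have h1 := invNum_revPerm_mul u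
  have h2 := invNum_revPerm_mul v
  rw [permLength_eq_invNum, permLength_eq_invNum] at hl
  refine ⟨by rw [permLength_eq_invNum, permLength_eq_invNum]; omega, (revPerm n * v) a,
    (revPerm n * v) b, by simpa [revPerm_mul_apply, hv] using hu, ?_⟩
  rw [← mul_swap_eq_swap_mul, hv]
  simp [mul_assoc]

lemma BruhatLE.revPerm_mul {n : ℕ} {u v : Perm (Fin n)} (h : BruhatLE u v) :
    BruhatLE (revPerm n * v) (revPerm n * u) := by
  induction h with
  | refl => exact BruhatLE.refl _
  | tail _ h ih => exact h.revPerm_mul.le.trans ih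

lemma bruhatLE_revPerm {n : ℕ} (u : Perm (Fin n)) : BruhatLE u (revPerm n) := by
  have := (one_bruhatLE (revPerm n * u)).revPerm_mul
  rwa [revPerm_mul_cancel, mul_one] at this

lemma BruhatLE.eq_revPerm {n : ℕ} {u : Perm (Fin n)} (h : BruhatLE (revPerm n) u) :
    u = revPerm n := by
  have := h.revPerm_mul
  rw [revPerm_mul_self] at this
  rw [← revPerm_mul_cancel u, this.eq_one, mul_one]

/-! ### Prefix sums -/

lemma permPoint_mul_swap {n : ℕ} (u : Perm (Fin n)) (a b : Fin n) :
    permPoint (u * swap a b) = permPoint u +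
      (((u b).val : ℝ) - (u a).val) • (Pi.single a 1 - Pi.single b 1) := by
  ext i
  simp only [permPoint, Perm.coe_mul, Function.comp_apply, Pi.add_apply, Pi.smul_apply,
    Pi.sub_apply, Pi.single_apply, smul_eq_mul]
  by_cases ha : i = a
  · subst ha
    by_cases hb : i = b
    · simp [hb]
    · simp only [swap_apply_left, if_true, if_neg hb]
      ring
  · by_cases hb : i = b
    · subst hb
      simp only [swap_apply_right, if_true, if_neg ha]
      ring
    · simp [swap_apply_of_ne_of_ne ha hb, ha, hb]

lemma dotProduct_permPoint_mul_swap {n : ℕ} (g : Fin n → ℝ) (u : Perm (Fin n)) (a b : Fin n) :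
    g ⬝ᵥ permPoint (u * swap a b) = g ⬝ᵥ permPoint u +
      (g a - g b) * (((u b).val : ℝ) - (u a).val) := by
  rw [permPoint_mul_swap, dotProduct_add, dotProduct_smul, dotProduct_sub]
  simp [mul_comm]

/-- The sum of the first `j` entries of the one-line notation of `u`. -/
def prefixSum {n : ℕ} (j : ℕ) (u : Perm (Fin n)) : ℕ :=
  ∑ i : Fin n, if i.val < j then (u i).val + 1 else 0

/-- The set of the first `j` entries of the one-line notation of `u`, with values in `Fin n`. -/
def prefixImage {n : ℕ} (j : ℕ) (u : Perm (Fin n)) : Finset (Fin n) :=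
  univ.filter fun k => (u⁻¹ k).val < j

lemma mem_prefixImage {n j : ℕ} {u : Perm (Fin n)} {k : Fin n} :
    k ∈ prefixImage j u ↔ (u⁻¹ k).val < j := by simp [prefixImage]

lemma firstSum_dotProduct_permPoint {n : ℕ} (j : ℕ) (u : Perm (Fin n)) :
    firstSum n j ⬝ᵥ permPoint u = prefixSum j u := by
  simp [dotProduct, firstSum, permPoint, prefixSum]

lemma prefixSum_eq_sum {n : ℕ} (j : ℕ) (u : Perm (Fin n)) :
    prefixSum j u = ∑ k ∈ prefixImage j u, (k.val + 1) := by
  rw [prefixSum, prefixImage, sum_filter, ← Equiv.sum_comp u (fun k => if (u⁻¹ k).val < j then k.val + 1 else 0)]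
  simp

lemma card_prefixImage {n : ℕ} (j : ℕ) (u : Perm (Fin n)) :
    (prefixImage j u).card = (univ.filter fun i : Fin n => i.val < j).card := by
  refine Finset.card_bij' (fun k _ => u⁻¹ k) (fun k _ => u k) ?_ ?_ ?_ ?_ <;> simp [prefixImage]

lemma prefixSum_mul_swap {n : ℕ} (j : ℕ) (u : Perm (Fin n)) (a b : Fin n) :
    (prefixSum j (u * swap a b) : ℝ) = prefixSum j u +
      (firstSum n j a - firstSum n j b) * (((u b).val : ℝ) - (u a).val) := by
  rw [← firstSum_dotProduct_permPoint, ← firstSum_dotProduct_permPoint,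
    dotProduct_permPoint_mul_swap]

lemma prefixSum_mul_swap_of_iff {n j : ℕ} (u : Perm (Fin n)) {a b : Fin n}
    (h : a.val < j ↔ b.val < j) : prefixSum j (u * swap a b) = prefixSum j u := by
  have := prefixSum_mul_swap j u a b
  simp only [firstSum, h, sub_self, zero_mul, add_zero] at this
  exact_mod_cast this

lemma prefixSum_mul_swap_of_lt {n j : ℕ} (u : Perm (Fin n)) {a b : Fin n}
    (ha : a.val < j) (hb : j ≤ b.val) :
    prefixSum j (u * swap a b) + (u a).val = prefixSum j u + (u b).val := by
  have := prefixSum_mul_swap j u a b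
  simp only [firstSum, ha, if_true, not_lt.2 hb, if_false] at this
  have h : (prefixSum j (u * swap a b) + (u a).val : ℝ) = prefixSum j u + (u b).val := by
    rw [this]; ring
  exact_mod_cast h

lemma prefixImage_mul_swap_of_iff {n j : ℕ} (u : Perm (Fin n)) {a b : Fin n}
    (h : a.val < j ↔ b.val < j) : prefixImage j (u * swap a b) = prefixImage j u := by
  ext k
  simp only [mem_prefixImage, mul_inv_rev, swap_inv, Perm.coe_mul, Function.comp_apply,
    swap_apply_def]
  split_ifs with h1 h2
  · rw [h1, h]
  · rw [h2, h]
  · rfl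

lemma mem_prefixImage_swap_mul {n j : ℕ} (u : Perm (Fin n)) (k l m : Fin n) :
    m ∈ prefixImage j (swap k l * u) ↔ swap k l m ∈ prefixImage j u := by
  simp [mem_prefixImage]

lemma prefixSum_swap_mul {n j : ℕ} (u : Perm (Fin n)) {k l : Fin n}
    (hk : k ∈ prefixImage j u) (hl : l ∉ prefixImage j u) :
    prefixSum j (swap k l * u) + k.val = prefixSum j u + l.val := by
  rw [mem_prefixImage] at hk hl
  have := prefixSum_mul_swap_of_lt u hk (not_lt.1 hl)
  rw [mul_swap_eq_swap_mul] at this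
  simpa using this

/-- A cover that swaps positions across the boundary at `j` strictly raises the prefix sum; one that
swaps within a block changes neither the sum nor the set. Hence equality of sums leaves no room for
a change of the set. -/
lemma BruhatLE.prefixSum_le {n : ℕ} (j : ℕ) {u v : Perm (Fin n)} (h : BruhatLE u v) :
    prefixSum j u ≤ prefixSum j v ∧
      (prefixSum j u = prefixSum j v → prefixImage j u = prefixImage j v) := by
  induction h with
  | refl => exact ⟨le_rfl, fun _ => rfl⟩
  | @tail v w _ h ih =>
    obtain ⟨a, b, hab, hlt, rfl⟩ := h.exists_swap
    rw [Fin.lt_def] at hab hlt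
    by_cases hj : a.val < j ↔ b.val < j
    · rwa [prefixSum_mul_swap_of_iff v hj, prefixImage_mul_swap_of_iff v hj]
    · have := prefixSum_mul_swap_of_lt v (j := j) (a := a) (b := b) (by omega) (by omega)
      constructor
      · omega
      · intro; omega

lemma isLowerSet_of_adjacent {n : ℕ} {A : Finset (Fin n)}
    (h : ∀ k l : Fin n, k.val + 1 = l.val → l ∈ A → k ∈ A) : IsLowerSet (A : Set (Fin n)) := by
  intro l k hkl hl
  obtain ⟨d, hd⟩ : ∃ d, l.val = k.val + d := Nat.exists_eq_add_of_le hkl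
  induction d generalizing k with
  | zero => rwa [show k = l from Fin.ext hd.symm]
  | succ d ih =>
    have hlt := l.isLt
    have := ih (k := ⟨k.val + 1, by omega⟩) (by rw [Fin.le_def]; simp only; omega)
      (by simp only; omega)
    exact h _ _ rfl this

lemma prefixImage_eq_of_isLowerSet {n j : ℕ} {u v : Perm (Fin n)}
    (hu : IsLowerSet (prefixImage j u : Set (Fin n)))
    (hv : IsLowerSet (prefixImage j v : Set (Fin n))) : prefixImage j u = prefixImage j v := by
  have hc : (prefixImage j u).card = (prefixImage j v).card := by
    rw [card_prefixImage, card_prefixImage]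
  rcases hu.total hv with h | h
  · exact Finset.eq_of_subset_of_card_le (by exact_mod_cast h) hc.ge
  · exact (Finset.eq_of_subset_of_card_le (by exact_mod_cast h) hc.le).symm

lemma prefixImage_one (n j : ℕ) :
    prefixImage j (1 : Perm (Fin n)) = univ.filter fun k => k.val < j := by
  simp [prefixImage]

lemma isLowerSet_prefixImage_one (n j : ℕ) :
    IsLowerSet (prefixImage j (1 : Perm (Fin n)) : Set (Fin n)) := by
  intro l k hkl hl
  rw [mem_coe, prefixImage_one, mem_filter] at hl ⊢
  exact ⟨mem_univ _, lt_of_le_of_lt hkl hl.2⟩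

lemma mem_prefixImage_revPerm_mul {n j : ℕ} (u : Perm (Fin n)) (k : Fin n) :
    k ∈ prefixImage j (revPerm n * u) ↔ Fin.rev k ∈ prefixImage j u := by
  rw [mem_prefixImage, mem_prefixImage, mul_inv_rev]
  rfl

lemma prefixSum_revPerm_mul {n : ℕ} (j : ℕ) (u : Perm (Fin n)) :
    prefixSum j (revPerm n * u) + prefixSum j u =
      (univ.filter fun i : Fin n => i.val < j).card * (n + 1) := by
  rw [prefixSum, prefixSum, ← sum_add_distrib, card_filter, sum_mul]
  refine sum_congr rfl fun i _ => ?_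
  split_ifs
  · rw [revPerm_mul_apply, Fin.val_rev]
    have := (u i).isLt
    omega
  · simp

/-- An adjacent pair of values `k`, `k + 1` with `k + 1` in the prefix and `k` outside of it. -/
lemma exists_down_of_lt {n j : ℕ} {u : Perm (Fin n)}
    (h : prefixSum j (1 : Perm (Fin n)) < prefixSum j u) :
    ∃ k l : Fin n, k.val + 1 = l.val ∧ k ∉ prefixImage j u ∧ l ∈ prefixImage j u := by
  by_contra! hc
  have hl : IsLowerSet (prefixImage j u : Set (Fin n)) :=
    isLowerSet_of_adjacent fun k l hkl hl => by_contra fun hk => hc k l hkl hk hl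
  have := prefixImage_eq_of_isLowerSet hl (isLowerSet_prefixImage_one n j)
  rw [prefixSum_eq_sum, prefixSum_eq_sum, this] at h
  exact lt_irrefl _ h

lemma exists_up_of_lt {n j : ℕ} {u : Perm (Fin n)}
    (h : prefixSum j u < prefixSum j (revPerm n)) :
    ∃ k l : Fin n, k.val + 1 = l.val ∧ k ∈ prefixImage j u ∧ l ∉ prefixImage j u := by
  have h1 := prefixSum_revPerm_mul j u
  have h2 := prefixSum_revPerm_mul j (1 : Perm (Fin n))
  rw [mul_one] at h2
  obtain ⟨k, l, hkl, hk, hl⟩ := exists_down_of_lt (j := j) (u := revPerm n * u) (by omega)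
  rw [mem_prefixImage_revPerm_mul] at hk hl
  have := l.isLt
  exact ⟨_, _, by rw [Fin.val_rev, Fin.val_rev]; omega, hl, hk⟩

/-! ### Level sets of prefix sums with a unique prefix -/

/-- All permutations whose first `j` entries have sum `b` have the same set of first `j` entries. -/
def PrefixUnique (n j b : ℕ) : Prop :=
  ∀ u v : Perm (Fin n), prefixSum j u = b → prefixSum j v = b → prefixImage j u = prefixImage j v

/-- `u` is decreasing on the first `j` positions and on the remaining ones. -/
def BlockDecreasing {n : ℕ} (j : ℕ) (u : Perm (Fin n)) : Prop :=
  ∀ p q : Fin n, p < q → (p.val < j ↔ q.val < j) → u q < u p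

lemma blockDecreasing_of_adjacent {n j : ℕ} {u : Perm (Fin n)}
    (h : ∀ p q : Fin n, p.val + 1 = q.val → (p.val < j ↔ q.val < j) → u q < u p) :
    BlockDecreasing j u := by
  intro p q hpq hj
  rw [Fin.lt_def] at hpq
  obtain ⟨d, hd⟩ : ∃ d, q.val = p.val + 1 + d := Nat.exists_eq_add_of_le hpq
  induction d generalizing p with
  | zero => exact h p q hd.symm hj
  | succ d ih =>
    have hlt := q.isLt
    have h1 := ih (p := ⟨p.val + 1, by omega⟩) (by simp only; omega) (by simp only; omega)
      (by simp only; omega)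
    exact h1.trans (h p ⟨p.val + 1, by omega⟩ rfl (by simp only; omega))

/-- Equal prefix sets make `v⁻¹ * u` preserve the two blocks of positions, and it is increasing on
each block, so it is the identity. -/
lemma BlockDecreasing.eq_of_prefixImage_eq {n j : ℕ} {u v : Perm (Fin n)}
    (hu : BlockDecreasing j u) (hv : BlockDecreasing j v)
    (h : prefixImage j u = prefixImage j v) : u = v := by
  have hb : ∀ p : Fin n, (v⁻¹ (u p)).val < j ↔ p.val < j := by
    intro p
    rw [← mem_prefixImage, ← h, mem_prefixImage]
    simp
  suffices v⁻¹ * u = 1 by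
    rw [inv_mul_eq_one] at this
    exact this.symm
  refine eq_one_of_adjacent fun p q hpq => ?_
  have hlt : p < q := by rw [Fin.lt_def]; omega
  simp only [Perm.coe_mul, Function.comp_apply]
  by_cases hj : p.val < j ↔ q.val < j
  · have h1 := hu p q hlt hj
    by_contra hc
    rcases eq_or_lt_of_le (not_lt.1 hc) with he | hl
    · have := u.injective (v⁻¹.injective he)
      exact hlt.ne this.symm
    · have := hv _ _ hl (by rw [hb, hb]; exact hj.symm)
      have e : ∀ x, v (v⁻¹ x) = x := v.apply_symm_apply
      rw [e, e] at this
      exact lt_asymm h1 this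
  · have h1 := hb p
    have h2 := hb q
    rw [Fin.lt_def]
    omega

lemma invNum_revPerm_mul_lt {n : ℕ} {u v : Perm (Fin n)} (h : BruhatCover u v) :
    invNum (revPerm n * v) < invNum (revPerm n * u) := by
  have := h.revPerm_mul.1
  rw [permLength_eq_invNum, permLength_eq_invNum] at this
  omega

/-- A greedy climb: sort ascents inside the blocks at constant prefix sum; when none remain and the
sum is still below `b`, raise one prefix value by one. Every move is a Bruhat cover, so the colength
decreases and the climb stops. -/
lemma exists_blockDecreasing_ge {n j b : ℕ} (hb : b ≤ prefixSum j (revPerm n))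
    (u : Perm (Fin n)) (hu : prefixSum j u ≤ b) :
    ∃ v, BruhatLE u v ∧ prefixSum j v = b ∧ BlockDecreasing j v := by
  induction hk : invNum (revPerm n * u) using Nat.strong_induction_on generalizing u with
  | _ k ih =>
    subst hk
    by_cases hd : ∀ p q : Fin n, p.val + 1 = q.val → (p.val < j ↔ q.val < j) → u q < u p
    · rcases eq_or_lt_of_le hu with he | hlt
      · exact ⟨u, BruhatLE.refl u, he, blockDecreasing_of_adjacent hd⟩
      · obtain ⟨k, l, hkl, hk, hl⟩ := exists_up_of_lt (hlt.trans_le hb)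
        have hs := prefixSum_swap_mul u hk hl
        rw [mem_prefixImage] at hk hl
        have hc := bruhatCover_swap_mul (u := u) hkl (by rw [Fin.lt_def]; omega)
        obtain ⟨v, hv⟩ := ih _ (invNum_revPerm_mul_lt hc) _ (by omega) rfl
        exact ⟨v, hc.le.trans hv.1, hv.2⟩
    · push Not at hd
      obtain ⟨p, q, hpq, hj, hle⟩ := hd
      have hlt : u p < u q := lt_of_le_of_ne hle fun he => by
        have := u.injective he
        subst this
        omega
      have hc := bruhatCover_mul_swap hpq hlt
      obtain ⟨v, hv⟩ := ih _ (invNum_revPerm_mul_lt hc) _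
        (by rwa [prefixSum_mul_swap_of_iff u hj]) rfl
      exact ⟨v, hc.le.trans hv.1, hv.2⟩

/-- All climbs from below end at the same permutation, because a block-decreasing permutation is
determined by its prefix set and the level has only one. -/
lemma PrefixUnique.exists_lower_interval {n j b : ℕ} (h : PrefixUnique n j b)
    (h1 : prefixSum j (1 : Perm (Fin n)) ≤ b) (h2 : b ≤ prefixSum j (revPerm n)) :
    ∃ v : Perm (Fin n), ∀ z, BruhatLE z v ↔ prefixSum j z ≤ b := by
  obtain ⟨v, -, hv, hd⟩ := exists_blockDecreasing_ge h2 1 h1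
  refine ⟨v, fun z => ⟨fun hz => hv ▸ (hz.prefixSum_le j).1, fun hz => ?_⟩⟩
  obtain ⟨w, hzw, hw, hd'⟩ := exists_blockDecreasing_ge h2 z hz
  rwa [hd.eq_of_prefixImage_eq hd' (h _ _ hv hw)]

lemma PrefixUnique.dual {n j b b' : ℕ} (h : PrefixUnique n j b)
    (hb : b' + b = (univ.filter fun i : Fin n => i.val < j).card * (n + 1)) :
    PrefixUnique n j b' := by
  intro u v hu hv
  have h1 := prefixSum_revPerm_mul j u
  have h2 := prefixSum_revPerm_mul j v
  have h3 := h (revPerm n * u) (revPerm n * v) (by omega) (by omega)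
  ext k
  have h4 := mem_prefixImage_revPerm_mul (j := j) u (Fin.rev k)
  have h5 := mem_prefixImage_revPerm_mul (j := j) v (Fin.rev k)
  rw [Fin.rev_rev] at h4 h5
  rw [← h4, ← h5, h3]

lemma PrefixUnique.exists_upper_interval {n j b : ℕ} (h : PrefixUnique n j b)
    (h1 : prefixSum j (1 : Perm (Fin n)) ≤ b) (h2 : b ≤ prefixSum j (revPerm n)) :
    ∃ v : Perm (Fin n), ∀ z, BruhatLE v z ↔ b ≤ prefixSum j z := by
  have h3 := prefixSum_revPerm_mul j (1 : Perm (Fin n))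
  rw [mul_one] at h3
  obtain ⟨b', hb'⟩ : ∃ b', b' + b = (univ.filter fun i : Fin n => i.val < j).card * (n + 1) :=
    ⟨_, Nat.sub_add_cancel (by omega)⟩
  obtain ⟨v, hv⟩ := (h.dual hb').exists_lower_interval (by omega) (by omega)
  refine ⟨revPerm n * v, fun z => ?_⟩
  have h4 := hv (revPerm n * z)
  have h5 := prefixSum_revPerm_mul j z
  rw [show b ≤ prefixSum j z ↔ prefixSum j (revPerm n * z) ≤ b' by omega, ← h4]
  constructor
  · intro h
    simpa [revPerm_mul_cancel] using h.revPerm_mul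
  · intro h
    simpa [revPerm_mul_cancel] using h.revPerm_mul

/-! ### Classification of the prefix sums with a unique prefix -/

lemma prefixUnique_min_add_one {n j : ℕ} :
    PrefixUnique n j (prefixSum j (1 : Perm (Fin n)) + 1) := by
  have key : ∀ u : Perm (Fin n), prefixSum j u = prefixSum j (1 : Perm (Fin n)) + 1 →
      ∃ k l : Fin n, k.val + 1 = l.val ∧ l.val = j ∧
        ∀ m, m ∈ prefixImage j u ↔ swap k l m ∈ prefixImage j 1 := by
    intro u hu
    obtain ⟨k, l, hkl, hk, hl⟩ := exists_down_of_lt (j := j) (u := u) (by omega)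
    have h1 := prefixSum_swap_mul u hl hk
    -- The down move reaches the minimal sum, where the prefix set must be that of the identity.
    -- Undoing the move then forces `l = j`.
    have h2 := ((one_bruhatLE (swap l k * u)).prefixSum_le j).2 (by omega)
    have h3 : ∀ m, m ∈ prefixImage j u ↔ swap k l m ∈ prefixImage j 1 := by
      intro m
      rw [h2, mem_prefixImage_swap_mul, swap_comm l k, swap_apply_self]
    refine ⟨k, l, hkl, ?_, h3⟩
    rw [h3] at hk hl
    simp only [prefixImage_one, mem_filter, mem_univ, true_and, swap_apply_left,
      swap_apply_right] at hk hl
    omega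
  intro u v hu hv
  obtain ⟨k, l, hkl, hl, h⟩ := key u hu
  obtain ⟨k', l', hkl', hl', h'⟩ := key v hv
  have h1 : k = k' := Fin.ext (by omega)
  have h2 : l = l' := Fin.ext (by omega)
  subst h1 h2
  ext m
  rw [h, h']

lemma prefixUnique_max_sub_one {n j b : ℕ} (hb : b + 1 = prefixSum j (revPerm n)) :
    PrefixUnique n j b := by
  have h3 := prefixSum_revPerm_mul j (1 : Perm (Fin n))
  rw [mul_one] at h3
  exact (prefixUnique_min_add_one (n := n) (j := j)).dual (by omega)

lemma prefixSum_first {n : ℕ} (u : Perm (Fin n)) (i : Fin n) (hi : i.val = 0) :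
    prefixSum 1 u = (u i).val + 1 := by
  rw [prefixSum, Finset.sum_eq_single i]
  · simp [hi]
  · intro k _ hk
    rw [if_neg]
    intro h
    exact hk (Fin.ext (by omega))
  · simp

lemma prefixSum_last {n j : ℕ} (u : Perm (Fin n)) (i : Fin n) (hi : i.val + 1 = n)
    (hj : j + 1 = n) : prefixSum j u + ((u i).val + 1) = ∑ k : Fin n, (k.val + 1) := by
  rw [← Equiv.sum_comp u (fun k : Fin n => k.val + 1), ← Finset.sum_erase_add _ _ (mem_univ i),
    prefixSum, ← Finset.sum_erase_add _ _ (mem_univ i), if_neg (by omega), add_zero]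
  congr 1
  refine sum_congr rfl fun k hk => if_pos ?_
  have h1 : k.val ≠ i.val := fun h => (ne_of_mem_erase hk) (Fin.ext h)
  have := k.isLt
  omega

lemma prefixUnique_one (n b : ℕ) : PrefixUnique n 1 b := by
  intro u v hu hv
  ext k
  have hn := k.pos
  have h1 := prefixSum_first u ⟨0, hn⟩ rfl
  have h2 := prefixSum_first v ⟨0, hn⟩ rfl
  have h3 : u ⟨0, hn⟩ = v ⟨0, hn⟩ := Fin.ext (by omega)
  have h4 : ∀ w : Perm (Fin n), k ∈ prefixImage 1 w ↔ k = w ⟨0, hn⟩ := by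
    intro w
    rw [mem_prefixImage, ← Perm.inv_eq_iff_eq, Fin.ext_iff]
    exact Nat.lt_one_iff
  rw [h4, h4, h3]

lemma prefixUnique_of_add_one_eq {n j : ℕ} (hj : j + 1 = n) (b : ℕ) : PrefixUnique n j b := by
  intro u v hu hv
  ext k
  have h1 := prefixSum_last u ⟨j, by omega⟩ hj hj
  have h2 := prefixSum_last v ⟨j, by omega⟩ hj hj
  have h3 : u ⟨j, by omega⟩ = v ⟨j, by omega⟩ := Fin.ext (by omega)
  have h4 : ∀ w : Perm (Fin n), k ∈ prefixImage j w ↔ ¬ k = w ⟨j, by omega⟩ := by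
    intro w
    rw [mem_prefixImage, ← Perm.inv_eq_iff_eq, Fin.ext_iff]
    have := (w⁻¹ k).isLt
    simp only
    omega
  rw [h4, h4, h3]

/-- If the pairs `{a, a'}` and `{c, c'}` were disjoint, lowering `a'` to `a` and raising `c` to `c'`
would give another prefix set with the same sum. -/
lemma PrefixUnique.overlap {n j b : ℕ} (h : PrefixUnique n j b) {u : Perm (Fin n)}
    (hu : prefixSum j u = b) {a a' c c' : Fin n} (ha : a.val + 1 = a'.val)
    (hc : c.val + 1 = c'.val) (h1 : a ∉ prefixImage j u) (h2 : a' ∈ prefixImage j u)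
    (h3 : c ∈ prefixImage j u) (h4 : c' ∉ prefixImage j u) : a' = c ∨ a = c' := by
  by_contra! hne
  have hac : a ≠ c := fun h => h1 (h ▸ h3)
  have hac' : a' ≠ c' := fun h => h4 (h ▸ h2)
  have e1 : swap a' a c = c := swap_apply_of_ne_of_ne hne.1.symm hac.symm
  have e2 : swap a' a c' = c' := swap_apply_of_ne_of_ne hac'.symm hne.2.symm
  have s1 := prefixSum_swap_mul u h2 h1
  have s2 := prefixSum_swap_mul (swap a' a * u) (k := c) (l := c') (j := j)
    (by rwa [mem_prefixImage_swap_mul, e1]) (by rwa [mem_prefixImage_swap_mul, e2])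
  have := h _ _ hu (show prefixSum j (swap c c' * (swap a' a * u)) = b by omega)
  rw [this, mem_prefixImage_swap_mul, mem_prefixImage_swap_mul, swap_apply_left, e2] at h3
  exact h4 h3

lemma exists_transition {n : ℕ} {P : Fin n → Prop} {x y : Fin n} (hxy : x ≤ y) (hx : P x)
    (hy : ¬ P y) : ∃ c c' : Fin n, c.val + 1 = c'.val ∧ x ≤ c ∧ c' ≤ y ∧ P c ∧ ¬ P c' := by
  obtain ⟨d, hd⟩ : ∃ d, y.val = x.val + d := Nat.exists_eq_add_of_le hxy
  induction d generalizing x with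
  | zero => exact absurd (Fin.ext hd ▸ hx) hy
  | succ d ih =>
    have hlt := y.isLt
    by_cases h : P ⟨x.val + 1, by omega⟩
    · obtain ⟨c, c', h1, h2, h3⟩ := ih (by rw [Fin.le_def]; simp only; omega) h
        (by simp only; omega)
      exact ⟨c, c', h1, le_trans (by rw [Fin.le_def]; simp) h2, h3⟩
    · exact ⟨x, ⟨x.val + 1, by omega⟩, rfl, le_rfl, by rw [Fin.le_def]; simp only; omega, hx, h⟩

/-- Read the prefix set as a 0/1 word starting with 1. By `PrefixUnique.overlap` its first gap is a
single 0 and there is no later return from 0 to 1, so the word is `1…101…10…0`. If it ends in 0, the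
1s after the gap reduce to a single one, and the sum is one above the minimum; if it ends in 1, only
one value is missing. -/
lemma PrefixUnique.of_head_mem {n j b : ℕ} (h : PrefixUnique n j b) {u : Perm (Fin n)}
    (hu : prefixSum j u = b) {o t : Fin n} (ho : o.val = 0) (ht : t.val + 1 = n)
    (ho' : o ∈ prefixImage j u) (h1 : prefixSum j (1 : Perm (Fin n)) < b) :
    (t ∉ prefixImage j u → b = prefixSum j (1 : Perm (Fin n)) + 1) ∧
      (t ∈ prefixImage j u → ∃ a, ∀ x, x ∉ prefixImage j u ↔ x = a) := by
  obtain ⟨a, a', ha, haA, haA'⟩ := exists_down_of_lt (hu ▸ h1)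
  have hov := fun {a a' c c'} => h.overlap (a := a) (a' := a') (c := c) (c' := c') hu
  have hle : ∀ x : Fin n, o ≤ x ∧ x ≤ t := fun x => by
    have := x.isLt
    rw [Fin.le_def, Fin.le_def]
    omega
  -- This up move lies entirely at or below `a`, so it overlaps no down move that starts above `a`;
  -- `hup` rests on this.
  obtain ⟨e, e', he, -, hea, heA, heA'⟩ :=
    exists_transition (P := fun x => x ∈ prefixImage j u) (hle a).1 ho' haA
  have up : ∀ {x y : Fin n}, x ≤ y → x ∉ prefixImage j u → y ∈ prefixImage j u →
      ∃ d d' : Fin n, d.val + 1 = d'.val ∧ x ≤ d ∧ d' ≤ y ∧ d ∉ prefixImage j u ∧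
        d' ∈ prefixImage j u := fun hxy hx hy => by
    obtain ⟨d, d', hd⟩ := exists_transition (P := fun x => x ∉ prefixImage j u) hxy hx
      (not_not.2 hy)
    exact ⟨d, d', by simpa only [not_not] using hd⟩
  have hlow : ∀ x, x < a → x ∈ prefixImage j u := by
    intro x hx
    by_contra hxA
    obtain ⟨c, c', hc, -, hcx, hcA, hcA'⟩ :=
      exists_transition (P := fun x => x ∈ prefixImage j u) (hle x).1 ho' hxA
    have := hov ha hc haA haA' hcA hcA'
    omega
  have hup : ∀ {d d' : Fin n}, d.val + 1 = d'.val → d ∉ prefixImage j u →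
      d' ∈ prefixImage j u → ¬ a < d := by
    intro d d' hd hdA hdA' hlt
    have := hov hd he hdA hdA' heA heA'
    omega
  constructor
  · intro htA
    obtain ⟨c, c', hc, hac, -, hcA, hcA'⟩ :=
      exists_transition (P := fun x => x ∈ prefixImage j u) (hle a').2 haA' htA
    have hca : a' = c := by
      have := hov ha hc haA haA' hcA hcA'
      omega
    subst hca
    have hhigh : ∀ x, a' < x → x ∉ prefixImage j u := by
      intro x hx hxA
      obtain ⟨d, d', hd, hcd, -, hdA, hdA'⟩ := up (x := c') (y := x) (by omega) hcA' hxA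
      exact hup hd hdA hdA' (by omega)
    have hlower : IsLowerSet (prefixImage j (swap a' a * u) : Set (Fin n)) := by
      have hm : ∀ x, x ∈ prefixImage j (swap a' a * u) ↔ x ≤ a := by
        intro x
        rw [mem_prefixImage_swap_mul]
        rcases lt_trichotomy x a with hx | rfl | hx
        · rw [swap_apply_of_ne_of_ne (by omega) (by omega)]
          exact iff_of_true (hlow x hx) hx.le
        · simpa using haA'
        · rcases eq_or_ne x a' with rfl | hne
          · rw [swap_apply_left]
            exact iff_of_false haA (by omega)
          · rw [swap_apply_of_ne_of_ne hne (by omega)]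
            exact iff_of_false (hhigh x (by omega)) (by omega)
      intro x y hxy hx
      rw [mem_coe, hm] at hx ⊢
      exact hxy.trans hx
    have h2 := prefixImage_eq_of_isLowerSet hlower (isLowerSet_prefixImage_one n j)
    have h3 := prefixSum_swap_mul u haA' haA
    rw [prefixSum_eq_sum j (swap a' a * u), h2, ← prefixSum_eq_sum] at h3
    omega
  · intro htA
    refine ⟨a, fun x => ⟨fun hx => ?_, fun hx => hx ▸ haA⟩⟩
    by_contra hne
    have hax : a < x := lt_of_le_of_ne (not_lt.1 fun hlt => hx (hlow x hlt)) (Ne.symm hne)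
    obtain ⟨d, d', hd, hxd, -, hdA, hdA'⟩ := up (hle x).2 hx htA
    exact hup hd hdA hdA' (by omega)

lemma PrefixUnique.of_ends_notMem {n j b : ℕ} (h : PrefixUnique n j b) {u : Perm (Fin n)}
    (hu : prefixSum j u = b) {o t : Fin n} (ho : o.val = 0) (ht : t.val + 1 = n)
    (ho' : o ∉ prefixImage j u) (ht' : t ∉ prefixImage j u)
    (h2 : b < prefixSum j (revPerm n)) : ∃ c, ∀ x, x ∈ prefixImage j u ↔ x = c := by
  obtain ⟨c, c', hc, hcA, hcA'⟩ := exists_up_of_lt (hu ▸ h2)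
  have hov := fun {a a' c c'} => h.overlap (a := a) (a' := a') (c := c) (c' := c') hu
  have hle : ∀ x : Fin n, o ≤ x ∧ x ≤ t := fun x => by
    have := x.isLt
    rw [Fin.le_def, Fin.le_def]
    omega
  have up : ∀ {y : Fin n}, y ∈ prefixImage j u → ∃ d d' : Fin n, d.val + 1 = d'.val ∧ d' ≤ y ∧
      d ∉ prefixImage j u ∧ d' ∈ prefixImage j u := fun {y} hy => by
    obtain ⟨d, d', hd⟩ := exists_transition (P := fun x => x ∉ prefixImage j u) (hle y).1 ho'
      (not_not.2 hy)
    exact ⟨d, d', hd.1, by simpa only [not_not] using hd.2.2⟩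
  refine ⟨c, fun x => ⟨fun hx => ?_, fun hx => hx ▸ hcA⟩⟩
  by_contra hne
  rcases lt_or_gt_of_ne hne with hlt | hlt
  · obtain ⟨a, a', ha, hax, haA, haA'⟩ := up hx
    have := hov ha hc haA haA' hcA hcA'
    omega
  · obtain ⟨a, a', ha, hax, haA, haA'⟩ := up hcA
    obtain ⟨d, d', hd, hxd, -, hdA, hdA'⟩ :=
      exists_transition (P := fun x => x ∈ prefixImage j u) (hle x).2 hx ht'
    have := hov ha hd haA haA' hdA hdA'
    omega

lemma PrefixUnique.classification {n j b : ℕ} (h : PrefixUnique n j b) {u : Perm (Fin n)}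
    (hu : prefixSum j u = b) (hn : 0 < n) (hj : j ≤ n)
    (h1 : prefixSum j (1 : Perm (Fin n)) < b) (h2 : b < prefixSum j (revPerm n)) :
    j = 1 ∨ j + 1 = n ∨ b = prefixSum j (1 : Perm (Fin n)) + 1 ∨
      b + 1 = prefixSum j (revPerm n) := by
  have hcard : (prefixImage j u).card = j := by
    rw [card_prefixImage, Fin.card_filter_val_lt]
    omega
  have hz : (0 : ℕ) = (⟨0, hn⟩ : Fin n).val := rfl
  have hl : (⟨n - 1, by omega⟩ : Fin n).val + 1 = n := Nat.sub_add_cancel hn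
  by_cases ho : (⟨0, hn⟩ : Fin n) ∈ prefixImage j u
  · obtain ⟨h3, h4⟩ := h.of_head_mem hu hz.symm hl ho h1
    by_cases ht : (⟨n - 1, by omega⟩ : Fin n) ∈ prefixImage j u
    · obtain ⟨a, ha⟩ := h4 ht
      have : (prefixImage j u)ᶜ = {a} := by
        ext x; rw [mem_compl, ha, mem_singleton]
      have h5 := card_compl (prefixImage j u)
      rw [this, card_singleton, Fintype.card_fin] at h5
      omega
    · exact Or.inr (Or.inr (Or.inl (h3 ht)))
  · by_cases ht : (⟨n - 1, by omega⟩ : Fin n) ∈ prefixImage j u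
    · have s1 := prefixSum_revPerm_mul j (1 : Perm (Fin n))
      have s2 := prefixSum_revPerm_mul j u
      rw [mul_one] at s1
      have hd := h.dual (b' := prefixSum j (revPerm n * u)) (by omega)
      have hr : Fin.rev (⟨0, hn⟩ : Fin n) = ⟨n - 1, by omega⟩ := by ext; simp [Fin.val_rev]
      have hr' : Fin.rev (⟨n - 1, by omega⟩ : Fin n) = ⟨0, hn⟩ := by
        rw [← hr, Fin.rev_rev]
      have := (hd.of_head_mem rfl hz.symm hl (by rwa [mem_prefixImage_revPerm_mul, hr])
        (by omega)).1 (by rwa [mem_prefixImage_revPerm_mul, hr'])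
      omega
    · obtain ⟨c, hc⟩ := h.of_ends_notMem hu hz.symm hl ho ht h2
      have : prefixImage j u = {c} := by
        ext x; rw [hc, mem_singleton]
      rw [this, card_singleton] at hcard
      omega

/-! ### Faces of polytopes -/

section Polytopes

variable {E : Type*} [NormedAddCommGroup E] [NormedSpace ℝ E]

lemma le_of_mem_convexHull {s : Set E} {l : StrongDual ℝ E} {c : ℝ} (h : ∀ x ∈ s, l x ≤ c) {x : E}
    (hx : x ∈ convexHull ℝ s) : l x ≤ c :=
  convexHull_min (t := {x | l x ≤ c}) h (convex_halfSpace_le l.isLinear c) hx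

lemma ge_of_mem_convexHull {s : Set E} {l : StrongDual ℝ E} {c : ℝ} (h : ∀ x ∈ s, c ≤ l x) {x : E}
    (hx : x ∈ convexHull ℝ s) : c ≤ l x :=
  convexHull_min (t := {x | c ≤ l x}) h (convex_halfSpace_ge l.isLinear c) hx

/-- A convex combination attains the bound `c` only if every point of positive weight does. -/
lemma mem_convexHull_level {s : Set E} {l : StrongDual ℝ E} {c : ℝ} (h : ∀ x ∈ s, l x ≤ c) {x : E}
    (hx : x ∈ convexHull ℝ s) (hxc : l x = c) : x ∈ convexHull ℝ {y ∈ s | l y = c} := by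
  refine (convexHull_min (t := {x | l x ≤ c ∧ (l x = c → x ∈ convexHull ℝ {y ∈ s | l y = c})})
    (fun y hy => ⟨h y hy, fun hc => subset_convexHull ℝ _ ⟨hy, hc⟩⟩) ?_ hx).2 hxc
  rintro y ⟨hy, hy'⟩ z ⟨hz, hz'⟩ a b ha hb hab
  have he : l (a • y + b • z) = a * l y + b * l z := by simp
  rw [Set.mem_ofPred_eq, he]
  have h1 : a * l y ≤ a * c := mul_le_mul_of_nonneg_left hy ha
  have h2 : b * l z ≤ b * c := mul_le_mul_of_nonneg_left hz hb
  have h3 : a * c + b * c = c := by rw [← add_mul, hab, one_mul]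
  refine ⟨by linarith, fun hc => ?_⟩
  rcases ha.eq_or_lt with rfl | ha'
  · rw [zero_add] at hab
    subst hab
    simpa using hz' (by simpa using hc)
  rcases hb.eq_or_lt with rfl | hb'
  · rw [add_zero] at hab
    subst hab
    simpa using hy' (by simpa using hc)
  refine convex_convexHull ℝ _ (hy' ?_) (hz' ?_) ha hb hab
  · exact mul_left_cancel₀ ha'.ne' (by linarith)
  · exact mul_left_cancel₀ hb'.ne' (by linarith)

lemma IsExposed.eq_convexHull {s B : Set E} (h : IsExposed ℝ (convexHull ℝ s) B) :
    B = convexHull ℝ (s ∩ B) := by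
  refine subset_antisymm ?_ (convexHull_min Set.inter_subset_right (h.convex (convex_convexHull ℝ s)))
  intro x hx
  obtain ⟨l, hl⟩ := h ⟨x, hx⟩
  have hx' := hx
  rw [hl] at hx'
  refine convexHull_mono ?_ (mem_convexHull_level (c := l x)
    (fun y hy => hx'.2 y (subset_convexHull ℝ s hy)) hx'.1 rfl)
  rintro y ⟨hy, hyx⟩
  refine ⟨hy, ?_⟩
  rw [hl]
  exact ⟨subset_convexHull ℝ s hy, fun z hz => hyx ▸ hx'.2 z hz⟩

/-- A face of a face is a face of a polytope: add the second functional to a large multiple of the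
first, so that the first decides wherever it is not maximal. Finiteness of `s` supplies a uniform
multiple. -/
lemma IsExposed.trans_of_finite {s B C : Set E} (hs : s.Finite)
    (hB : IsExposed ℝ (convexHull ℝ s) B) (hC : IsExposed ℝ B C) :
    IsExposed ℝ (convexHull ℝ s) C := by
  rintro ⟨x, hx⟩
  have hxB := hC.subset hx
  obtain ⟨l₁, h₁⟩ := hB ⟨x, hxB⟩
  obtain ⟨l₂, h₂⟩ := hC ⟨x, hx⟩
  have hx₁ := hxB
  rw [h₁] at hx₁
  have hx₂ := hx
  rw [h₂] at hx₂
  obtain ⟨K, hK⟩ : ∃ K : ℝ, ∀ y ∈ s, l₁ y < l₁ x → K * l₁ y + l₂ y < K * l₁ x + l₂ x := by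
    -- Points with `l₁ y = l₁ x` contribute the default value `0` of the quotient, which is
    -- harmless; the extra `1` below makes the inequality strict.
    obtain ⟨K, hK⟩ := (hs.toFinset.image fun y => (l₂ y - l₂ x) / (l₁ x - l₁ y)).exists_le
    refine ⟨K + 1, fun y hy hlt => ?_⟩
    have h := hK _ (mem_image_of_mem _ (hs.mem_toFinset.2 hy))
    rw [div_le_iff₀ (by linarith)] at h
    linarith
  set l : StrongDual ℝ E := K • l₁ + l₂ with hl
  have hl' : ∀ y, l y = K * l₁ y + l₂ y := fun y => by simp [hl]
  have hmem : ∀ y ∈ s, l₁ y = l₁ x → y ∈ B := by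
    intro y hy he
    rw [h₁]
    exact ⟨subset_convexHull ℝ s hy, fun z hz => he ▸ hx₁.2 z hz⟩
  have hle : ∀ y ∈ s, l y ≤ l x := by
    intro y hy
    rw [hl', hl']
    rcases (hx₁.2 y (subset_convexHull ℝ s hy)).lt_or_eq with hlt | he
    · exact (hK y hy hlt).le
    · have := hx₂.2 y (hmem y hy he)
      rw [he]
      linarith
  refine ⟨l, ?_⟩
  ext z
  constructor
  · intro hz
    have hzB := hC.subset hz
    have hz' := hz
    rw [h₂] at hz'
    have hzB' := hzB
    rw [h₁] at hzB'
    have e1 : l₁ z = l₁ x := le_antisymm (hx₁.2 _ hzB'.1) (hzB'.2 _ hx₁.1)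
    have e2 : l₂ z = l₂ x := le_antisymm (hx₂.2 _ hzB) (hz'.2 _ hxB)
    refine ⟨hzB'.1, fun y hy => ?_⟩
    rw [hl' z, e1, e2, ← hl']
    exact le_of_mem_convexHull hle hy
  · rintro ⟨hz, hz'⟩
    have hconv : Convex ℝ C := hC.convex (hB.convex (convex_convexHull ℝ s))
    refine convexHull_min ?_ hconv (mem_convexHull_level hle hz
      (le_antisymm (le_of_mem_convexHull hle hz) (hz' x hx₁.1)))
    rintro y ⟨hy, hyx⟩
    have h1 : l₁ y = l₁ x := by
      rcases (hx₁.2 y (subset_convexHull ℝ s hy)).lt_or_eq with hlt | he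
      · have := hK y hy hlt
        rw [hl', hl'] at hyx
        linarith
      · exact he
    rw [hl', hl', h1] at hyx
    rw [h₂]
    exact ⟨hmem y hy h1, fun w hw => by linarith [hx₂.2 w hw]⟩

lemma finite_setOf_isExposed {s : Set E} (hs : s.Finite) :
    {C | IsExposed ℝ (convexHull ℝ s) C}.Finite := by
  refine (hs.finite_subsets.image (convexHull ℝ)).subset fun C hC => ?_
  exact ⟨s ∩ C, Set.inter_subset_left, (IsExposed.eq_convexHull hC).symm⟩

lemma isExposed_level {A : Set E} {l : StrongDual ℝ E} {c : ℝ} (h : ∀ x ∈ A, l x ≤ c) :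
    IsExposed ℝ A {x ∈ A | l x = c} := by
  rintro ⟨x, hx, hxc⟩
  refine ⟨l, Set.ext fun y => and_congr_right fun hy => ⟨fun hyc z hz => hyc ▸ h z hz, fun hz => ?_⟩⟩
  exact le_antisymm (h y hy) (hxc ▸ hz x hx)

/-- A point of the convex hull of finitely many points `p i` in the half-space `f ≤ b` is a convex
combination of the points `p i` in this half-space, if no minimal face jumps over `f = b`. -/
lemma mem_convexHull_halfSpace {ι : Type*} [Finite ι] (p : ι → E) (f : StrongDual ℝ E) (b : ℝ)
    (hK : ∀ (g : StrongDual ℝ E) (y z : ι), (∀ i, g (p y) ≤ g (p i)) → (∀ i, g (p z) ≤ g (p i)) →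
      f (p z) ≤ b → b ≤ f (p y) → ∃ w, (∀ i, g (p w) ≤ g (p i)) ∧ f (p w) = b)
    {x : E} (hx : x ∈ convexHull ℝ (Set.range p)) (hxb : f x ≤ b) :
    x ∈ convexHull ℝ (p '' {i | f (p i) ≤ b}) := by
  classical
  have := Fintype.ofFinite ι
  by_contra hcon
  have hfin : (p '' {i | f (p i) ≤ b}).Finite := Set.toFinite _
  obtain ⟨g, u, hgx, hu⟩ := geometric_hahn_banach_point_closed (convex_convexHull ℝ _)
    (hfin.isCompact_convexHull ℝ).isClosed hcon
  have hu' : ∀ i, f (p i) ≤ b → u < g (p i) := fun i hi =>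
    hu _ (subset_convexHull ℝ _ ⟨i, hi, rfl⟩)
  set A : Finset ι := univ.filter fun i => f (p i) ≤ b with hA
  set B : Finset ι := univ.filter fun i => b < f (p i) with hB
  have hAne : A.Nonempty := by
    by_contra hne
    rw [not_nonempty_iff_eq_empty, hA, filter_eq_empty_iff] at hne
    have : x ∈ {x | b < f x} := convexHull_min (by
      rintro _ ⟨i, rfl⟩
      exact not_le.1 (hne (mem_univ i))) (convex_halfSpace_gt f.isLinear b) hx
    exact absurd hxb (not_le.2 this)
  have hBne : B.Nonempty := by
    by_contra hne
    rw [not_nonempty_iff_eq_empty, hB, filter_eq_empty_iff] at hne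
    have : u ≤ g x := ge_of_mem_convexHull (by
      rintro _ ⟨i, rfl⟩
      exact (hu' i (not_lt.1 (hne (mem_univ i)))).le) hx
    linarith
  obtain ⟨i₀, hi₀⟩ := hAne
  have hi₀' : f (p i₀) ≤ b := by simpa [hA] using hi₀
  -- Tilt the separating functional to `g + t • f`. At `t = 0` its minimum over `B` is no larger
  -- than over `A`; at `max T 0` the order is reversed, since `i₀` then does at least as well as all
  -- of `B`. At some `t` between, the two minima agree, giving minimizers on both sides of the level
  -- `b`.
  obtain ⟨T, hT⟩ := (B.image fun k => (g (p i₀) - g (p k)) / (f (p k) - f (p i₀))).exists_le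
  have hcont : ∀ (D : Finset ι) (hD : D.Nonempty),
      Continuous fun t : ℝ => D.inf' hD fun i => g (p i) + t * f (p i) := fun D hD =>
    Continuous.finset_inf'_apply hD fun i _ => by fun_prop
  have hpos : (0 : ℝ) ≤ max T 0 := le_max_right _ _
  obtain ⟨t, ht, heq⟩ := isPreconnected_Icc.intermediate_value₂
    (Set.left_mem_Icc.2 hpos) (Set.right_mem_Icc.2 hpos)
    (hcont B hBne).continuousOn (hcont A ⟨i₀, hi₀⟩).continuousOn (by
      by_contra hlt
      rw [not_le] at hlt
      have : u ≤ g x := ge_of_mem_convexHull (by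
        rintro _ ⟨i, rfl⟩
        by_cases hi : f (p i) ≤ b
        · exact (hu' i hi).le
        · have h1 : B.inf' hBne (fun i => g (p i) + 0 * f (p i)) ≤ g (p i) + 0 * f (p i) :=
            inf'_le _ (by simpa [hB] using hi)
          obtain ⟨k, hk, hk'⟩ := exists_mem_eq_inf' ⟨i₀, hi₀⟩ (fun i => g (p i) + 0 * f (p i))
          rw [hk'] at hlt
          have := hu' k (by simpa [hA] using hk)
          linarith) hx
      linarith) (by
      refine (inf'_le _ hi₀).trans ?_
      rw [le_inf'_iff]
      intro k hk
      have h1 := hT _ (mem_image_of_mem _ hk)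
      have h2 : b < f (p k) := by simpa [hB] using hk
      have h3 := h1.trans (le_max_left T 0)
      rw [div_le_iff₀ (by linarith)] at h3
      linarith)
  obtain ⟨y, hy, hy'⟩ := exists_mem_eq_inf' hBne (fun i => g (p i) + t * f (p i))
  obtain ⟨z, hz, hz'⟩ := exists_mem_eq_inf' ⟨i₀, hi₀⟩ (fun i => g (p i) + t * f (p i))
  have hyB : b < f (p y) := by simpa [hB] using hy
  have hzA : f (p z) ≤ b := by simpa [hA] using hz
  have hmin : ∀ i, g (p z) + t * f (p z) ≤ g (p i) + t * f (p i) := by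
    intro i
    by_cases hi : f (p i) ≤ b
    · rw [← hz']
      exact inf'_le (fun i => g (p i) + t * f (p i)) (by simpa [hA] using hi)
    · rw [← hz', ← heq]
      exact inf'_le (fun i => g (p i) + t * f (p i)) (by simpa [hB] using hi)
  have hyz : g (p y) + t * f (p y) = g (p z) + t * f (p z) := by rw [← hy', ← hz', heq]
  have hgt : ∀ x, (g + t • f) x = g x + t * f x := fun x => by simp
  obtain ⟨w, hw, hwb⟩ := hK (g + t • f) y z (fun i => by rw [hgt, hgt, hyz]; exact hmin i)
    (fun i => by rw [hgt, hgt]; exact hmin i) hzA hyB.le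
  -- As `f x ≤ b = f (p w)` and `0 ≤ t`, this gives `g (p w) ≤ g x`, against the separation by `u`.
  have h1 : (g + t • f) (p w) ≤ (g + t • f) x := ge_of_mem_convexHull (by
    rintro _ ⟨i, rfl⟩
    exact hw i) hx
  rw [hgt, hgt, hwb] at h1
  have h2 : t * f x ≤ t * b := mul_le_mul_of_nonneg_left hxb ht.1
  have h3 := hu' w hwb.le
  linarith

end Polytopes

/-! ### Gluing two polytopes along a hyperplane -/

/-- The faces of two polytopes. -/
def gluedFaces {n : ℕ} (F₁ F₂ : Set (Fin n → ℝ)) : Set (Set (Fin n → ℝ)) :=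
  {C | IsExposed ℝ F₁ C ∨ IsExposed ℝ F₂ C}

lemma isSplit_gluedFaces {n : ℕ} {s₁ s₂ P : Set (Fin n → ℝ)} (h₁ : s₁.Finite) (h₂ : s₂.Finite)
    {l : StrongDual ℝ (Fin n → ℝ)} {c : ℝ}
    (hl₁ : convexHull ℝ s₁ = {x ∈ P | l x ≤ c}) (hl₂ : convexHull ℝ s₂ = {x ∈ P | c ≤ l x})
    (he₁ : s₁ ⊆ P.extremePoints ℝ) (he₂ : s₂ ⊆ P.extremePoints ℝ)
    (hlt : ∃ x ∈ P, l x < c) (hgt : ∃ x ∈ P, c < l x) :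
    IsSplit P (gluedFaces (convexHull ℝ s₁) (convexHull ℝ s₂))
      (convexHull ℝ s₁) (convexHull ℝ s₂) := by
  set F₁ := convexHull ℝ s₁ with hF₁
  set F₂ := convexHull ℝ s₂ with hF₂
  have hG₁ : IsExposed ℝ F₁ (F₁ ∩ F₂) := by
    have h : F₁ ∩ F₂ = {x ∈ F₁ | l x = c} := by
      rw [hl₁, hl₂]
      ext x
      exact ⟨fun h => ⟨h.1, le_antisymm h.1.2 h.2.2⟩, fun h => ⟨h.1, h.1.1, h.2.ge⟩⟩
    rw [h]
    exact isExposed_level (by rw [hl₁]; exact fun x hx => hx.2)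
  have hG₂ : IsExposed ℝ F₂ (F₁ ∩ F₂) := by
    have h : F₁ ∩ F₂ = {x ∈ F₂ | (-l) x = -c} := by
      rw [hl₁, hl₂]
      ext x
      exact ⟨fun h => ⟨h.2, congrArg Neg.neg (le_antisymm h.1.2 h.2.2)⟩,
        fun h => ⟨⟨h.1.1, (neg_inj.1 h.2).le⟩, h.1⟩⟩
    rw [h]
    exact isExposed_level (by rw [hl₂]; exact fun x hx => neg_le_neg hx.2)
  have hn₁ : ¬ F₁ ⊆ F₂ := by
    obtain ⟨x, hx, hxc⟩ := hlt
    intro h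
    have h1 : x ∈ F₂ := h (by rw [hl₁]; exact ⟨hx, hxc.le⟩)
    rw [hl₂] at h1
    exact absurd hxc (not_lt.2 h1.2)
  have hn₂ : ¬ F₂ ⊆ F₁ := by
    obtain ⟨x, hx, hxc⟩ := hgt
    intro h
    have h1 : x ∈ F₁ := h (by rw [hl₂]; exact ⟨hx, hxc.le⟩)
    rw [hl₁] at h1
    exact absurd hxc (not_lt.2 h1.2)
  have hmix : ∀ C D, IsExposed ℝ F₁ C → IsExposed ℝ F₂ D →
      IsExposed ℝ C (C ∩ D) ∧ IsExposed ℝ D (C ∩ D) := by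
    intro C D hC hD
    have h1 : IsExposed ℝ (F₁ ∩ F₂) (C ∩ (F₁ ∩ F₂)) :=
      (hC.inter hG₁).mono Set.inter_subset_left Set.inter_subset_right
    have h2 : IsExposed ℝ (F₁ ∩ F₂) (D ∩ (F₁ ∩ F₂)) :=
      (hD.inter hG₂).mono Set.inter_subset_right Set.inter_subset_right
    -- Faces of different cells meet inside the common face, where their intersection is an
    -- intersection of two faces of that face; transitivity carries it back to each cell.
    have h3 : C ∩ (F₁ ∩ F₂) ∩ (D ∩ (F₁ ∩ F₂)) = C ∩ D := by
      ext x
      have h5 : x ∈ C → x ∈ F₁ := fun h => hC.subset h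
      have h6 : x ∈ D → x ∈ F₂ := fun h => hD.subset h
      simp only [Set.mem_inter_iff]
      tauto
    have h4 := h1.inter h2
    rw [h3] at h4
    exact ⟨(hG₁.trans_of_finite h₁ h4).mono hC.subset Set.inter_subset_left,
      (hG₂.trans_of_finite h₂ h4).mono hD.subset Set.inter_subset_right⟩
  have hsame : ∀ {F C D : Set (Fin n → ℝ)}, IsExposed ℝ F C → IsExposed ℝ F D →
      IsExposed ℝ C (C ∩ D) ∧ IsExposed ℝ D (C ∩ D) := fun hC hD =>
    ⟨(hC.inter hD).mono hC.subset Set.inter_subset_left,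
      (hC.inter hD).mono hD.subset Set.inter_subset_right⟩
  have hpoly : ∀ {s C : Set (Fin n → ℝ)}, s.Finite → IsExposed ℝ (convexHull ℝ s) C →
      IsPolytope C := fun {s C} hs hC =>
    ⟨(hs.subset (Set.inter_subset_left (t := C))).toFinset, by
      rw [Set.Finite.coe_toFinset]; exact hC.eq_convexHull⟩
  have hvert : ∀ {s : Set (Fin n → ℝ)} {x : Fin n → ℝ}, IsExposed ℝ (convexHull ℝ s) {x} →
      x ∈ s := fun {s x} hx => by
    have h1 := hx.eq_convexHull
    have h2 : (s ∩ {x}).Nonempty := by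
      rw [← convexHull_nonempty_iff (𝕜 := ℝ), ← h1]
      exact Set.singleton_nonempty x
    obtain ⟨y, hy, rfl⟩ := h2
    exact hy
  have hm₁ : F₁ ∈ gluedFaces F₁ F₂ := Or.inl (IsExposed.refl F₁)
  have hm₂ : F₂ ∈ gluedFaces F₁ F₂ := Or.inr (IsExposed.refl F₂)
  refine ⟨⟨?_, ?_, ?_, ?_, ?_, ?_⟩, fun h => hn₁ h.le, ?_⟩
  · exact (finite_setOf_isExposed h₁).union (finite_setOf_isExposed h₂)
  · rintro C (hC | hC)
    · exact hpoly h₁ hC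
    · exact hpoly h₂ hC
  · rintro C (hC | hC) B hB
    · exact Or.inl (hC.trans_of_finite h₁ hB)
    · exact Or.inr (hC.trans_of_finite h₂ hB)
  · rintro C (hC | hC) D (hD | hD)
    · exact hsame hC hD
    · exact hmix C D hC hD
    · rw [Set.inter_comm]
      exact (hmix D C hD hC).symm
    · exact hsame hC hD
  · ext x
    constructor
    · rintro ⟨C, hC | hC, hx⟩
      · have h := hC.subset hx
        rw [hl₁] at h
        exact h.1
      · have h := hC.subset hx
        rw [hl₂] at h
        exact h.1
    · intro hx
      rcases le_total (l x) c with h | h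
      · exact ⟨F₁, hm₁, by rw [hl₁]; exact ⟨hx, h⟩⟩
      · exact ⟨F₂, hm₂, by rw [hl₂]; exact ⟨hx, h⟩⟩
  · rintro x (hx | hx)
    · exact he₁ (hvert hx)
    · exact he₂ (hvert hx)
  · intro F
    constructor
    · rintro ⟨hF | hF, hmax⟩
      · exact Or.inl (subset_antisymm hF.subset (hmax hm₁ hF.subset))
      · exact Or.inr (subset_antisymm hF.subset (hmax hm₂ hF.subset))
    · rintro (rfl | rfl)
      · refine ⟨hm₁, ?_⟩
        rintro C (hC | hC) hle
        · exact hC.subset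
        · exact absurd (hle.trans hC.subset) hn₁
      · refine ⟨hm₂, ?_⟩
        rintro C (hC | hC) hle
        · exact absurd (hle.trans hC.subset) hn₂
        · exact hC.subset

/-! ### The permutahedron -/

/-- The linear functional `x ↦ ∑ a_i x_i`. -/
noncomputable def dotFunctional {n : ℕ} (a : Fin n → ℝ) : StrongDual ℝ (Fin n → ℝ) :=
  ∑ i, a i • ContinuousLinearMap.proj (R := ℝ) (φ := fun _ : Fin n => ℝ) i

lemma dotFunctional_apply {n : ℕ} (a x : Fin n → ℝ) : dotFunctional a x = a ⬝ᵥ x := by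
  simp [dotFunctional, dotProduct]

lemma StrongDual.exists_eq_dotProduct {n : ℕ} (l : StrongDual ℝ (Fin n → ℝ)) :
    ∃ a : Fin n → ℝ, ∀ x, l x = a ⬝ᵥ x := by
  refine ⟨fun i => l (Pi.single i 1), fun x => ?_⟩
  conv_lhs => rw [← Finset.univ_sum_single x]
  rw [map_sum, dotProduct]
  refine sum_congr rfl fun i _ => ?_
  rw [mul_comm, ← smul_eq_mul, ← map_smul, ← Pi.single_smul, smul_eq_mul, mul_one]

/-! ### Permutations as the vertices of the permutahedron -/

lemma permPoint_injective (n : ℕ) : Function.Injective (permPoint (n := n)) := by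
  intro u v h
  ext i
  have := congrFun h i
  simpa [permPoint] using this

lemma sum_comp_permPoint {n : ℕ} (f : ℝ → ℝ) (u v : Perm (Fin n)) :
    ∑ i, f (permPoint u i) = ∑ i, f (permPoint v i) := by
  unfold permPoint
  rw [Equiv.sum_comp u (fun k : Fin n => f (k.val + 1)),
    Equiv.sum_comp v (fun k : Fin n => f (k.val + 1))]

/-- All permutations lie on one sphere around the origin, so each is the only maximizer of its own
inner product. -/
lemma permPoint_dotProduct_lt {n : ℕ} {u v : Perm (Fin n)} (h : v ≠ u) :
    permPoint u ⬝ᵥ permPoint v < permPoint u ⬝ᵥ permPoint u := by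
  have h1 : 0 < ∑ i, (permPoint u i - permPoint v i) ^ 2 := by
    obtain ⟨i, hi⟩ : ∃ i, permPoint u i ≠ permPoint v i := by
      by_contra! hc
      exact h (permPoint_injective n (funext hc)).symm
    exact Finset.sum_pos' (fun _ _ => sq_nonneg _)
      ⟨i, mem_univ i, sq_pos_of_ne_zero (sub_ne_zero.2 hi)⟩
  have h2 := sum_comp_permPoint (fun x => x ^ 2) u v
  have h3 : ∑ i, (permPoint u i - permPoint v i) ^ 2 =
      ∑ i, permPoint u i ^ 2 + ∑ i, permPoint v i ^ 2 - 2 * permPoint u ⬝ᵥ permPoint v := by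
    rw [dotProduct, mul_sum, ← sum_add_distrib, ← sum_sub_distrib]
    exact sum_congr rfl fun i _ => by ring
  have h4 : permPoint u ⬝ᵥ permPoint u = ∑ i, permPoint u i ^ 2 :=
    sum_congr rfl fun i _ => by ring
  linarith

lemma permPoint_mem_convexHull_iff {n : ℕ} {I : Set (Perm (Fin n))} {u : Perm (Fin n)} :
    permPoint u ∈ convexHull ℝ (permPoint '' I) ↔ u ∈ I := by
  refine ⟨fun h => ?_, fun h => subset_convexHull ℝ _ ⟨u, h, rfl⟩⟩
  by_contra hu
  have : permPoint u ∈ {x | dotFunctional (permPoint u) x < permPoint u ⬝ᵥ permPoint u} :=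
    convexHull_min (by
      rintro _ ⟨v, hv, rfl⟩
      refine (dotFunctional_apply _ _).trans_lt ?_
      exact permPoint_dotProduct_lt fun he => hu (he ▸ hv))
      (convex_halfSpace_lt (dotFunctional (permPoint u)).isLinear _) h
  exact lt_irrefl _ ((dotFunctional_apply _ _).symm.trans_lt this)

lemma permPoint_mem_permutahedron {n : ℕ} (u : Perm (Fin n)) : permPoint u ∈ permutahedron n :=
  subset_convexHull ℝ _ ⟨u, rfl⟩

lemma permPoint_mem_extremePoints {n : ℕ} (u : Perm (Fin n)) :
    permPoint u ∈ (permutahedron n).extremePoints ℝ := by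
  refine exposedPoints_subset_extremePoints ?_
  rw [mem_exposedPoints_iff_exposed_singleton]
  have hle : ∀ x ∈ Set.range (permPoint (n := n)),
      dotFunctional (permPoint u) x ≤ permPoint u ⬝ᵥ permPoint u := by
    rintro _ ⟨v, rfl⟩
    rw [dotFunctional_apply]
    by_cases h : v = u
    · rw [h]
    · exact (permPoint_dotProduct_lt h).le
  have h1 := isExposed_level (A := permutahedron n) fun x hx => le_of_mem_convexHull hle hx
  refine (?_ : ({permPoint u} : Set (Fin n → ℝ)) = {x ∈ permutahedron n |
    dotFunctional (permPoint u) x = permPoint u ⬝ᵥ permPoint u}) ▸ h1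
  refine Set.Subset.antisymm ?_ ?_
  · rintro _ rfl
    exact ⟨permPoint_mem_permutahedron u, dotFunctional_apply _ _⟩
  · rintro x ⟨hx, hxc⟩
    refine convexHull_min ?_ (convex_singleton _) (mem_convexHull_level hle hx hxc)
    rintro _ ⟨⟨v, rfl⟩, hv⟩
    rw [dotFunctional_apply] at hv
    by_contra hne
    exact (permPoint_dotProduct_lt fun h => hne (by rw [h]; rfl)).ne hv

/-- Two minimizers of a linear functional over the permutations are joined by a path of minimizers
along which prefix sums change by at most one. -/
lemma exists_minimizer_prefixSum_eq {n : ℕ} (g : Fin n → ℝ) (j b : ℕ) (y z : Perm (Fin n))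
    (hy : ∀ w, g ⬝ᵥ permPoint y ≤ g ⬝ᵥ permPoint w) (hz : ∀ w, g ⬝ᵥ permPoint z ≤ g ⬝ᵥ permPoint w)
    (hzb : prefixSum j z ≤ b) (hyb : b ≤ prefixSum j y) :
    ∃ w, (∀ v, g ⬝ᵥ permPoint w ≤ g ⬝ᵥ permPoint v) ∧ prefixSum j w = b := by
  induction hk : invNum (z * y⁻¹) using Nat.strong_induction_on generalizing y with
  | _ k ih =>
    subst hk
    rcases hyb.eq_or_lt with he | hlt
    · exact ⟨y, hy, he.symm⟩
    have hne : z * y⁻¹ ≠ 1 := by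
      intro h
      rw [mul_inv_eq_one] at h
      subst h
      omega
    obtain ⟨k, l, hkl, hd⟩ := exists_adjacent_descent hne
    set p := y⁻¹ k with hp
    set q := y⁻¹ l with hq
    have ep : y p = k := y.apply_symm_apply k
    have eq' : y q = l := y.apply_symm_apply l
    have hd' : z q < z p := hd
    have h1 := hy (y * swap p q)
    have h2 := hz (z * swap p q)
    rw [dotProduct_permPoint_mul_swap, ep, eq'] at h1
    rw [dotProduct_permPoint_mul_swap] at h2
    have h3 : ((l.val : ℝ) - k.val) = 1 := by rw [← hkl]; push_cast; ring
    have h4 : ((z q).val : ℝ) - (z p).val < 0 := by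
      rw [sub_neg]; exact_mod_cast hd'
    rw [h3] at h1
    -- The values at `p` and `q` are ordered oppositely in the minimizers `y` and `z`, so optimality
    -- of each gives one of the two inequalities. The values in `y` are consecutive, so swapping
    -- them moves the prefix sum by at most one.
    have h5 : g p - g q = 0 := by nlinarith
    refine ih _ ?_ (y * swap p q) ?_ ?_ rfl
    · have h6 : z * (y * swap p q)⁻¹ = z * y⁻¹ * swap k l := by
        rw [mul_inv_rev, swap_inv, mul_assoc, mul_swap_eq_swap_mul y⁻¹ k l]
      rw [h6]
      exact invNum_mul_swap_lt (by rw [Fin.lt_def]; omega) hd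
    · intro w
      rw [dotProduct_permPoint_mul_swap, h5, zero_mul, add_zero]
      exact hy w
    · have h7 := prefixSum_mul_swap j y p q
      rw [ep, eq', h3, mul_one] at h7
      have h8 : (-1 : ℝ) ≤ firstSum n j p - firstSum n j q := by
        unfold firstSum
        split_ifs <;> norm_num
      have h9 : (b : ℝ) + 1 ≤ prefixSum j y := by exact_mod_cast hlt
      have : (b : ℝ) ≤ prefixSum j (y * swap p q) := by linarith
      exact_mod_cast this

lemma mem_lowerHalf {n : ℕ} {a x : Fin n → ℝ} {b : ℝ} : x ∈ lowerHalf a b ↔ a ⬝ᵥ x ≤ b := Iff.rfl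

lemma mem_upperHalf {n : ℕ} {a x : Fin n → ℝ} {b : ℝ} : x ∈ upperHalf a b ↔ b ≤ a ⬝ᵥ x := Iff.rfl

lemma mem_hyperplane {n : ℕ} {a x : Fin n → ℝ} {b : ℝ} : x ∈ hyperplane a b ↔ a ⬝ᵥ x = b := Iff.rfl

/-! ### Sections of the permutahedron by prefix sums, and their affine spans -/

lemma permutahedron_inter_lowerHalf (n j b : ℕ) :
    permutahedron n ∩ lowerHalf (firstSum n j) b =
      convexHull ℝ (permPoint '' {z : Perm (Fin n) | prefixSum j z ≤ b}) := by
  have hmem : ∀ z : Perm (Fin n), dotFunctional (firstSum n j) (permPoint z) ≤ (b : ℝ) ↔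
      prefixSum j z ≤ b := fun z => by
    rw [dotFunctional_apply, firstSum_dotProduct_permPoint, Nat.cast_le]
  refine subset_antisymm ?_ fun x hx => ⟨convexHull_mono (Set.image_subset_range _ _) hx, ?_⟩
  · rintro x ⟨hx, hxb⟩
    have := mem_convexHull_halfSpace permPoint (dotFunctional (firstSum n j)) b ?_ hx
      (by rw [dotFunctional_apply]; exact hxb)
    · simpa only [hmem] using this
    · intro g y z hy hz hzb hyb
      obtain ⟨a, ha⟩ := g.exists_eq_dotProduct
      simp only [ha] at hy hz ⊢
      simp only [dotFunctional_apply, firstSum_dotProduct_permPoint, Nat.cast_le,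
        Nat.cast_inj] at hzb hyb ⊢
      exact exists_minimizer_prefixSum_eq _ j b y z hy hz hzb hyb
  · rw [mem_lowerHalf, ← dotFunctional_apply]
    refine le_of_mem_convexHull ?_ hx
    rintro _ ⟨z, hz, rfl⟩
    exact (hmem z).2 hz

lemma permutahedron_inter_upperHalf (n j b : ℕ) :
    permutahedron n ∩ upperHalf (firstSum n j) b =
      convexHull ℝ (permPoint '' {z : Perm (Fin n) | b ≤ prefixSum j z}) := by
  have hneg : ∀ x, (-dotFunctional (firstSum n j)) x ≤ -(b : ℝ) ↔ (b : ℝ) ≤ firstSum n j ⬝ᵥ x :=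
    fun x => by rw [_root_.neg_apply, neg_le_neg_iff, dotFunctional_apply]
  have hmem : ∀ z : Perm (Fin n), (-dotFunctional (firstSum n j)) (permPoint z) ≤ -(b : ℝ) ↔
      b ≤ prefixSum j z := fun z => by
    rw [hneg, firstSum_dotProduct_permPoint, Nat.cast_le]
  refine subset_antisymm ?_ fun x hx => ⟨convexHull_mono (Set.image_subset_range _ _) hx, ?_⟩
  · rintro x ⟨hx, hxb⟩
    have := mem_convexHull_halfSpace permPoint (-dotFunctional (firstSum n j)) (-b) ?_ hx
      ((hneg x).2 hxb)
    · simpa only [hmem] using this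
    · intro g y z hy hz hzb hyb
      obtain ⟨a, ha⟩ := g.exists_eq_dotProduct
      simp only [ha] at hy hz ⊢
      simp only [_root_.neg_apply, neg_le_neg_iff, neg_inj, dotFunctional_apply,
        firstSum_dotProduct_permPoint, Nat.cast_le, Nat.cast_inj] at hzb hyb ⊢
      exact exists_minimizer_prefixSum_eq _ j b z y hz hy hyb hzb
  · rw [mem_upperHalf, ← hneg]
    refine le_of_mem_convexHull ?_ hx
    rintro _ ⟨z, hz, rfl⟩
    exact (hmem z).2 hz

lemma permutahedron_inter_hyperplane (n j b : ℕ) :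
    permutahedron n ∩ hyperplane (firstSum n j) b =
      convexHull ℝ (permPoint '' {z : Perm (Fin n) | prefixSum j z = b}) := by
  have hle := fun x => le_of_mem_convexHull (s := permPoint '' {z : Perm (Fin n) | prefixSum j z ≤ b})
      (l := dotFunctional (firstSum n j)) (c := b) (x := x) (by
        rintro _ ⟨z, hz, rfl⟩
        rw [dotFunctional_apply, firstSum_dotProduct_permPoint, Nat.cast_le]
        exact hz)
  refine subset_antisymm ?_ fun x hx => ⟨convexHull_mono (Set.image_subset_range _ _) hx, ?_⟩
  · rintro x ⟨hx, hxb⟩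
    have h1 : x ∈ permutahedron n ∩ lowerHalf (firstSum n j) b := ⟨hx, le_of_eq hxb⟩
    rw [permutahedron_inter_lowerHalf] at h1
    have h2 := mem_convexHull_level (l := dotFunctional (firstSum n j)) (c := b)
      (fun y hy => hle y (subset_convexHull ℝ _ hy)) h1 (by rw [dotFunctional_apply]; exact hxb)
    refine convexHull_mono ?_ h2
    rintro _ ⟨⟨z, hz, rfl⟩, hzb⟩
    rw [dotFunctional_apply, firstSum_dotProduct_permPoint, Nat.cast_inj] at hzb
    exact ⟨z, hzb, rfl⟩
  · rw [mem_hyperplane, ← dotFunctional_apply]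
    refine le_antisymm (le_of_mem_convexHull ?_ hx) (ge_of_mem_convexHull ?_ hx)
    all_goals
      rintro _ ⟨z, hz, rfl⟩
      rw [dotFunctional_apply, firstSum_dotProduct_permPoint, Nat.cast_le]
    exacts [le_of_eq hz, ge_of_eq hz]

lemma sum_permPoint {n : ℕ} (u : Perm (Fin n)) :
    ∑ i, permPoint u i = ∑ k : Fin n, ((k.val : ℝ) + 1) :=
  Equiv.sum_comp u (fun k : Fin n => (k.val : ℝ) + 1)

lemma mem_affineSpan_prefixSum {n j b : ℕ} {u : Perm (Fin n)} (hu : prefixSum j u = b)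
    {x : Fin n → ℝ} : x ∈ affineSpan ℝ (permPoint '' {z : Perm (Fin n) | prefixSum j z = b}) ↔
      ∑ i, x i = ∑ k : Fin n, ((k.val : ℝ) + 1) ∧ firstSum n j ⬝ᵥ x = b := by
  set V := permPoint '' {z : Perm (Fin n) | prefixSum j z = b} with hV
  have hone : ∀ x : Fin n → ℝ, (1 : Fin n → ℝ) ⬝ᵥ x = ∑ i, x i := fun x => one_dotProduct x
  have hlevel : ∀ (a : Fin n → ℝ) (c : ℝ), (∀ z : Perm (Fin n), prefixSum j z = b →
      a ⬝ᵥ permPoint z = c) → ∀ x ∈ affineSpan ℝ V, a ⬝ᵥ x = c := by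
    intro a c h x hx
    refine affineSpan_induction hx ?_ ?_
    · rintro _ ⟨z, hz, rfl⟩
      exact h z hz
    · intro t u v w hu hv hw
      rw [vadd_eq_add, vsub_eq_sub, dotProduct_add, dotProduct_smul, dotProduct_sub, hu, hv, hw]
      simp
  constructor
  · intro hx
    refine ⟨?_, hlevel _ _ (fun z hz => ?_) x hx⟩
    · rw [← hone]
      exact hlevel _ _ (fun z _ => by rw [hone, sum_permPoint]) x hx
    · rw [firstSum_dotProduct_permPoint, hz]
  · rintro ⟨h1, h2⟩
    have huV : permPoint u ∈ affineSpan ℝ V := subset_affineSpan ℝ V ⟨u, hu, rfl⟩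
    -- Swaps inside a block stay on the level, so the direction contains all differences of
    -- coordinate vectors from one block. These span the vectors whose sum over each block vanishes;
    -- `o` and `t` below serve as base positions of the two blocks.
    have hdir : ∀ p q : Fin n, (p.val < j ↔ q.val < j) →
        Pi.single p (1 : ℝ) - Pi.single q 1 ∈ (affineSpan ℝ V).direction := by
      intro p q hpq
      rcases eq_or_ne p q with rfl | hne
      · rw [sub_self]; exact Submodule.zero_mem _
      have h3 : permPoint (u * swap p q) ∈ affineSpan ℝ V :=
        subset_affineSpan ℝ V ⟨_, by rw [Set.mem_ofPred_eq, prefixSum_mul_swap_of_iff u hpq, hu], rfl⟩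
      have h4 := AffineSubspace.vsub_mem_direction h3 huV
      rw [permPoint_mul_swap, vsub_eq_sub, add_sub_cancel_left] at h4
      refine (Submodule.smul_mem_iff _ ?_).1 h4
      rw [sub_ne_zero]
      intro he
      exact hne (u.injective (Fin.ext (by exact_mod_cast he.symm)))
    set w := x - permPoint u with hw
    have hw1 : ∑ i, w i = 0 := by
      rw [← hone, hw, dotProduct_sub, hone, hone, h1, sum_permPoint, sub_self]
    have hw2 : firstSum n j ⬝ᵥ w = 0 := by
      rw [hw, dotProduct_sub, h2, firstSum_dotProduct_permPoint, hu, sub_self]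
    suffices hwd : w ∈ (affineSpan ℝ V).direction by
      have := AffineSubspace.vadd_mem_of_mem_direction hwd huV
      rwa [vadd_eq_add, hw, sub_add_cancel] at this
    rcases Nat.eq_zero_or_pos n with rfl | hn
    · rw [Subsingleton.elim w 0]; exact Submodule.zero_mem _
    have h5 : ∑ i, (if i.val < j then w i else 0) = 0 := by
      refine Eq.trans ?_ hw2
      exact sum_congr rfl fun i _ => by rw [firstSum, ite_mul, one_mul, zero_mul]
    have h6 : ∑ i, (if i.val < j then 0 else w i) = 0 := by
      have : ∑ i, (if i.val < j then 0 else w i) + ∑ i, (if i.val < j then w i else 0) = 0 := by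
        rw [← sum_add_distrib]
        refine Eq.trans (sum_congr rfl fun i _ => ?_) hw1
        split_ifs
        exacts [zero_add _, add_zero _]
      rwa [h5, add_zero] at this
    set o : Fin n := ⟨0, hn⟩ with ho
    set t : Fin n := ⟨n - 1, by omega⟩ with ht
    have h7 : w = ∑ i, w i • (Pi.single i (1 : ℝ) - Pi.single (if i.val < j then o else t) 1) := by
      have h8 : ∑ i, w i • (Pi.single (if i.val < j then o else t) 1 : Fin n → ℝ) = 0 := by
        have : ∀ i, w i • (Pi.single (if i.val < j then o else t) 1 : Fin n → ℝ) =
            (if i.val < j then w i else 0) • Pi.single o 1 +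
              (if i.val < j then 0 else w i) • Pi.single t 1 := fun i => by
          split_ifs <;> simp
        rw [sum_congr rfl fun i _ => this i, sum_add_distrib, ← sum_smul, ← sum_smul, h5, h6,
          zero_smul, zero_smul, add_zero]
      simp only [smul_sub]
      rw [sum_sub_distrib, h8, sub_zero]
      conv_lhs => rw [← Finset.univ_sum_single w]
      exact sum_congr rfl fun i _ => by rw [← Pi.single_smul, smul_eq_mul, mul_one]
    rw [h7]
    refine Submodule.sum_mem _ fun i _ => Submodule.smul_mem _ _ (hdir _ _ ?_)
    have := i.isLt
    split_ifs with hi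
    · simp only [ho]; omega
    · simp only [ht]; omega

/-- This is the case `j = 0` of `mem_affineSpan_prefixSum`, where every permutation has prefix sum
zero. -/
lemma mem_affineSpan_permutahedron {n : ℕ} {x : Fin n → ℝ} :
    x ∈ affineSpan ℝ (permutahedron n) ↔ ∑ i, x i = ∑ k : Fin n, ((k.val : ℝ) + 1) := by
  have h0 : ∀ z : Perm (Fin n), prefixSum 0 z = 0 := fun z => by simp [prefixSum]
  have h1 := mem_affineSpan_prefixSum (x := x) (h0 1)
  have h2 : permPoint '' {z : Perm (Fin n) | prefixSum 0 z = 0} = Set.range permPoint := by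
    simp [h0]
  have h3 : firstSum n 0 ⬝ᵥ x = 0 := by simp [dotProduct, firstSum]
  rw [permutahedron, affineSpan_convexHull, ← h2, h1, h3]
  simp

/-! ### Hyperplane splits -/

lemma isHyperplaneSplit_of_isSplit {n j b : ℕ} {S : Set (Set (Fin n → ℝ))}
    {F₁ F₂ : Set (Fin n → ℝ)} (hs : IsSplit (permutahedron n) S F₁ F₂)
    (hc : (F₁ = permutahedron n ∩ lowerHalf (firstSum n j) b ∧
        F₂ = permutahedron n ∩ upperHalf (firstSum n j) b) ∨
      (F₁ = permutahedron n ∩ upperHalf (firstSum n j) b ∧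
        F₂ = permutahedron n ∩ lowerHalf (firstSum n j) b))
    {u : Perm (Fin n)} (hu : prefixSum j u = b) :
    IsHyperplaneSplit (permutahedron n) (firstSum n j) b S F₁ F₂ := by
  refine ⟨hs, ?_, hc⟩
  have h1 : F₁ ∩ F₂ = permutahedron n ∩ hyperplane (firstSum n j) b := by
    ext x
    rcases hc with ⟨rfl, rfl⟩ | ⟨rfl, rfl⟩
    · exact ⟨fun h => ⟨h.1.1, le_antisymm h.1.2 h.2.2⟩,
        fun h => ⟨⟨h.1, le_of_eq h.2⟩, h.1, ge_of_eq h.2⟩⟩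
    · exact ⟨fun h => ⟨h.1.1, le_antisymm h.2.2 h.1.2⟩,
        fun h => ⟨⟨h.1, ge_of_eq h.2⟩, h.1, le_of_eq h.2⟩⟩
  ext x
  rw [h1, permutahedron_inter_hyperplane, affineSpan_convexHull, SetLike.mem_coe,
    mem_affineSpan_prefixSum hu, Set.mem_inter_iff, SetLike.mem_coe, mem_affineSpan_permutahedron,
    mem_hyperplane]

lemma PrefixUnique.exists_isHyperplaneSplit {n j b : ℕ} (h : PrefixUnique n j b)
    (h1 : prefixSum j (1 : Perm (Fin n)) < b)
    (h2 : b < prefixSum j (revPerm n)) :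
    ∃ (S : Set (Set (Fin n → ℝ))) (F₁ F₂ : Set (Fin n → ℝ)),
      IsHyperplaneSplit (permutahedron n) (firstSum n j) b S F₁ F₂ ∧
        IsBruhatIntervalPolytope F₁ ∧ IsBruhatIntervalPolytope F₂ := by
  obtain ⟨u, -, hu, -⟩ := exists_blockDecreasing_ge h2.le 1 h1.le
  have hl := permutahedron_inter_lowerHalf n j b
  have hr := permutahedron_inter_upperHalf n j b
  have hlt : ∀ z : Perm (Fin n), dotFunctional (firstSum n j) (permPoint z) = prefixSum j z :=
    fun z => by rw [dotFunctional_apply, firstSum_dotProduct_permPoint]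
  refine ⟨_, _, _, isHyperplaneSplit_of_isSplit (isSplit_gluedFaces
    (s₁ := permPoint '' {z : Perm (Fin n) | prefixSum j z ≤ b})
    (s₂ := permPoint '' {z : Perm (Fin n) | b ≤ prefixSum j z}) (Set.toFinite _) (Set.toFinite _)
    (l := dotFunctional (firstSum n j)) (c := b) ?_ ?_ ?_ ?_
    ⟨permPoint 1, permPoint_mem_permutahedron _, ?_⟩
    ⟨permPoint (revPerm n), permPoint_mem_permutahedron _, ?_⟩) (Or.inl ⟨hl.symm, hr.symm⟩) hu,
    ?_, ?_⟩
  · rw [← hl]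
    ext x
    simp only [dotFunctional_apply]
    rfl
  · rw [← hr]
    ext x
    simp only [dotFunctional_apply]
    rfl
  · rintro _ ⟨z, -, rfl⟩
    exact permPoint_mem_extremePoints z
  · rintro _ ⟨z, -, rfl⟩
    exact permPoint_mem_extremePoints z
  · rw [hlt]; exact_mod_cast h1
  · rw [hlt]; exact_mod_cast h2
  · obtain ⟨v, hv⟩ := h.exists_lower_interval h1.le h2.le
    refine ⟨1, v, one_bruhatLE v, ?_⟩
    congr 2
    ext z
    exact ⟨fun hz => ⟨one_bruhatLE z, (hv z).2 hz⟩, fun hz => (hv z).1 hz.2⟩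
  · obtain ⟨v, hv⟩ := h.exists_upper_interval h1.le h2.le
    refine ⟨v, revPerm n, bruhatLE_revPerm v, ?_⟩
    congr 2
    ext z
    exact ⟨fun hz => ⟨(hv z).2 hz, bruhatLE_revPerm z⟩, fun hz => (hv z).1 hz.1⟩

/-! ### The hyperplane of a split -/

lemma IsPolytope.isClosed {n : ℕ} {C : Set (Fin n → ℝ)} (h : IsPolytope C) : IsClosed C := by
  obtain ⟨V, rfl⟩ := h
  exact (V.finite_toSet.isCompact_convexHull ℝ).isClosed

/-- The functional exposing `F₁ ∩ F₂` as a face of `F₁` works: by connectedness, passing from one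
cell to the other inside a convex subset of `P` crosses the common face, where the functional equals
its maximum over `F₁`. -/
lemma IsSplit.exists_halfSpaces {n : ℕ} {P : Set (Fin n → ℝ)} (hP : Convex ℝ P)
    {S : Set (Set (Fin n → ℝ))} {F₁ F₂ : Set (Fin n → ℝ)} (h : IsSplit P S F₁ F₂) :
    ∃ (l : StrongDual ℝ (Fin n → ℝ)) (c : ℝ), F₁ = {x ∈ P | l x ≤ c} ∧ F₂ = {x ∈ P | c ≤ l x} ∧
      (∃ x ∈ P, l x < c) ∧ ∃ x ∈ P, c < l x := by
  have hM₁ := (h.maximal_iff F₁).2 (Or.inl rfl)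
  have hM₂ := (h.maximal_iff F₂).2 (Or.inr rfl)
  have hcov : P = F₁ ∪ F₂ := by
    rw [← h.subdivision.cover]
    refine Set.Subset.antisymm ?_ (Set.union_subset (Set.subset_sUnion_of_mem hM₁.1)
      (Set.subset_sUnion_of_mem hM₂.1))
    rintro x ⟨C, hC, hx⟩
    obtain ⟨D, hCD, hD⟩ := h.subdivision.finite.exists_le_maximal hC
    rcases (h.maximal_iff D).1 hD with rfl | rfl
    · exact Or.inl (hCD hx)
    · exact Or.inr (hCD hx)
  have hn₁ : ¬ F₁ ⊆ F₂ := fun hle => h.ne (hle.antisymm (hM₁.2 hM₂.1 hle))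
  have hn₂ : ¬ F₂ ⊆ F₁ := fun hle => h.ne ((hM₂.2 hM₁.1 hle).antisymm hle)
  have hc₁ := (h.subdivision.polytope F₁ hM₁.1).isClosed
  have hc₂ := (h.subdivision.polytope F₂ hM₂.1).isClosed
  obtain ⟨a, ha₁, ha₂⟩ := Set.not_subset.1 hn₁
  obtain ⟨b, hb₂, hb₁⟩ := Set.not_subset.1 hn₂
  have haP : a ∈ P := hcov ▸ Or.inl ha₁
  have hbP : b ∈ P := hcov ▸ Or.inr hb₂
  have hcross : ∀ Q ⊆ P, Convex ℝ Q → (Q ∩ F₁).Nonempty → (Q ∩ F₂).Nonempty →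
      (Q ∩ (F₁ ∩ F₂)).Nonempty := fun Q hQ hQc h1 h2 =>
    isPreconnected_closed_iff.1 hQc.isPreconnected F₁ F₂ hc₁ hc₂ (hcov ▸ hQ) h1 h2
  obtain ⟨g, -, hg⟩ := hcross P subset_rfl hP ⟨a, haP, ha₁⟩ ⟨b, hbP, hb₂⟩
  obtain ⟨l, hl⟩ := (h.subdivision.inter_face F₁ hM₁.1 F₂ hM₂.1).1 ⟨g, hg⟩
  have hg' := hg
  rw [hl] at hg'
  have hG : ∀ x, x ∈ F₁ → (x ∈ F₂ ↔ l x = l g) := by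
    intro x hx
    constructor
    · intro hx₂
      have hx' : x ∈ F₁ ∩ F₂ := ⟨hx, hx₂⟩
      rw [hl] at hx'
      exact le_antisymm (hg'.2 x hx) (hx'.2 g hg'.1)
    · intro he
      have hx' : x ∈ F₁ ∩ F₂ := by
        rw [hl]
        exact ⟨hx, fun y hy => he ▸ hg'.2 y hy⟩
      exact hx'.2
  have hal : l a < l g := lt_of_le_of_ne (hg'.2 a ha₁) fun he => ha₂ ((hG a ha₁).2 he)
  have hlt : ∀ y ∈ P, l y < l g → y ∈ F₁ := by
    intro y hy hyl
    by_contra hy₁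
    have hy₂ : y ∈ F₂ := (hcov ▸ hy : y ∈ F₁ ∪ F₂).resolve_left hy₁
    -- The segment would have to meet the common face, but the functional stays strictly below its
    -- level there.
    obtain ⟨x, hx, hx₁, hx₂⟩ := hcross (segment ℝ a y) (hP.segment_subset haP hy)
      (convex_segment a y) ⟨a, left_mem_segment ℝ a y, ha₁⟩ ⟨y, right_mem_segment ℝ a y, hy₂⟩
    exact ((convex_halfSpace_lt l.isLinear (l g)).segment_subset hal hyl hx).ne ((hG x hx₁).1 hx₂)
  have hle : ∀ y ∈ P, l y ≤ l g → y ∈ F₁ := by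
    intro y hy hyl
    have hsub : openSegment ℝ a y ⊆ F₁ := by
      rintro x ⟨s, t, hs, ht, hst, rfl⟩
      refine hlt _ (hP haP hy hs.le ht.le hst) ?_
      have h1 : l (s • a + t • y) = s * l a + t * l y := by simp
      have h2 : s * l a < s * l g := mul_lt_mul_of_pos_left hal hs
      have h3 : t * l y ≤ t * l g := mul_le_mul_of_nonneg_left hyl ht.le
      have h4 : s * l g + t * l g = l g := by rw [← add_mul, hst, one_mul]
      linarith
    exact closure_minimal hsub hc₁ (segment_subset_closure_openSegment (right_mem_segment ℝ a y))
  have hF₁ : F₁ = {x ∈ P | l x ≤ l g} :=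
    Set.ext fun x => ⟨fun hx => ⟨hcov ▸ Or.inl hx, hg'.2 x hx⟩, fun hx => hle x hx.1 hx.2⟩
  refine ⟨l, l g, hF₁, Set.ext fun x => ⟨fun hx => ?_, fun hx => ?_⟩, ⟨a, haP, hal⟩,
    ⟨b, hbP, ?_⟩⟩
  · have hxP : x ∈ P := hcov ▸ Or.inr hx
    refine ⟨hxP, ?_⟩
    by_contra hxl
    rw [not_le] at hxl
    exact hxl.ne ((hG x (hlt x hxP hxl)).1 hx)
  · by_contra hx₂
    have hx₁ : x ∈ F₁ := (hcov ▸ hx.1 : x ∈ F₁ ∪ F₂).resolve_right hx₂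
    exact hx₂ ((hG x hx₁).2 (le_antisymm (hg'.2 x hx₁) hx.2))
  · by_contra hbl
    exact hb₁ (hle b hbP (not_lt.1 hbl))

/-! ### Functionals monotone in the Bruhat order, and the reduction to prefix sums -/

lemma BruhatLE.dotProduct_le {n : ℕ} {g : Fin n → ℝ} (hg : Antitone g) {u v : Perm (Fin n)}
    (h : BruhatLE u v) : g ⬝ᵥ permPoint u ≤ g ⬝ᵥ permPoint v := by
  induction h with
  | refl => exact le_rfl
  | @tail v w _ h ih =>
    obtain ⟨a, b, hab, hlt, rfl⟩ := h.exists_swap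
    rw [dotProduct_permPoint_mul_swap]
    have h1 : 0 ≤ g a - g b := sub_nonneg.2 (hg hab.le)
    have h2 : (0 : ℝ) ≤ (v b).val - (v a).val := sub_nonneg.2 (by exact_mod_cast hlt.le)
    have := mul_nonneg h1 h2
    linarith

lemma antitone_of_adjacent {n : ℕ} {g : Fin n → ℝ}
    (h : ∀ p q : Fin n, p.val + 1 = q.val → g q ≤ g p) : Antitone g := by
  cases n with
  | zero => exact fun a => a.elim0
  | succ n => exact Fin.antitone_iff_succ_le.2 fun i => h _ _ (by simp)

/-- A functional cutting the permutations into a lower and an upper Bruhat interval which overlap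
in the convex hull of their common elements is, on the permutations, a prefix sum with a unique
prefix. -/
lemma exists_prefixSum_of_intervals {n : ℕ} {h : Fin n → ℝ} {c : ℝ} {u v : Perm (Fin n)}
    (hv : ∀ z, h ⬝ᵥ permPoint z ≤ c ↔ BruhatLE z v) (hu : ∀ z, c ≤ h ⬝ᵥ permPoint z ↔ BruhatLE u z)
    (h1 : h ⬝ᵥ permPoint (1 : Perm (Fin n)) < c) (h2 : c < h ⬝ᵥ permPoint (revPerm n))
    (hconv : ∀ x ∈ permutahedron n, h ⬝ᵥ x = c →
      x ∈ convexHull ℝ (permPoint '' {z : Perm (Fin n) | h ⬝ᵥ permPoint z = c})) :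
    ∃ j, 1 ≤ j ∧ j + 1 ≤ n ∧ PrefixUnique n j (prefixSum j u) ∧
      ∀ z, (h ⬝ᵥ permPoint z ≤ c ↔ prefixSum j z ≤ prefixSum j u) ∧
        (c ≤ h ⬝ᵥ permPoint z ↔ prefixSum j u ≤ prefixSum j z) := by
  -- a convex combination on the hyperplane
  have hcross : ∀ z y : Perm (Fin n), h ⬝ᵥ permPoint z < c → c < h ⬝ᵥ permPoint y →
      ((h ⬝ᵥ permPoint y - c) / (h ⬝ᵥ permPoint y - h ⬝ᵥ permPoint z)) • permPoint z +
        ((c - h ⬝ᵥ permPoint z) / (h ⬝ᵥ permPoint y - h ⬝ᵥ permPoint z)) • permPoint y ∈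
      convexHull ℝ (permPoint '' {z : Perm (Fin n) | h ⬝ᵥ permPoint z = c}) := by
    intro z y hz hy
    have hpos : 0 < h ⬝ᵥ permPoint y - h ⬝ᵥ permPoint z := by linarith
    refine hconv _ (convex_convexHull ℝ _ (permPoint_mem_permutahedron z)
      (permPoint_mem_permutahedron y) (div_nonneg (by linarith) hpos.le)
      (div_nonneg (by linarith) hpos.le) ?_) ?_
    · field_simp
      ring
    · rw [dotProduct_add, dotProduct_smul, dotProduct_smul, smul_eq_mul, smul_eq_mul]
      field_simp
      ring
  obtain ⟨_, z₀, hz₀, -⟩ := convexHull_nonempty_iff.1 ⟨_, hcross 1 (revPerm n) h1 h2⟩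
  have huv : BruhatLE u v := ((hu z₀).1 (ge_of_eq hz₀)).trans ((hv z₀).1 (le_of_eq hz₀))
  have huc : h ⬝ᵥ permPoint u = c :=
    le_antisymm ((hv u).2 huv) ((hu u).2 (BruhatLE.refl u))
  have hvc : h ⬝ᵥ permPoint v = c :=
    le_antisymm ((hv v).2 (BruhatLE.refl v)) ((hu v).2 huv)
  have hanti : Antitone h := by
    -- An adjacent swap of `v` that goes up leaves `[1, v]` and so raises `h` above `c`; one that
    -- goes down stays inside and does not. Both give `h q ≤ h p`.
    refine antitone_of_adjacent fun p q hpq => ?_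
    have hne : v p ≠ v q := fun he => by
      have := v.injective he
      subst this
      omega
    have hs := dotProduct_permPoint_mul_swap h v p q
    rcases lt_or_gt_of_ne hne with hlt | hlt
    · have h3 := mt (hv _).1 (bruhatCover_mul_swap hpq hlt).not_le
      rw [hs, hvc] at h3
      have h4 : (0 : ℝ) < (v q).val - (v p).val := sub_pos.2 (by exact_mod_cast hlt)
      by_contra h5
      nlinarith
    · have h3 := (hv _).2 (bruhatLE_of_descent hpq hlt).le
      rw [hs, hvc] at h3
      have h4 : ((v q).val : ℝ) - (v p).val < 0 := sub_neg.2 (by exact_mod_cast hlt)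
      by_contra h5
      nlinarith
  obtain ⟨p, q, hpq, hdrop⟩ : ∃ p q : Fin n, p.val + 1 = q.val ∧ h q < h p := by
    by_contra! hc
    have hmono : Antitone (-h) := antitone_of_adjacent fun p q hpq => neg_le_neg (hc p q hpq)
    have h3 := (one_bruhatLE (revPerm n)).dotProduct_le hmono
    rw [neg_dotProduct, neg_dotProduct] at h3
    linarith
  obtain ⟨j, hj⟩ : ∃ j, j = q.val := ⟨_, rfl⟩
  have hpj : p.val < j := by omega
  -- Removing the drop between the adjacent positions `p` and `q` makes the coefficients equal there
  -- and keeps them decreasing. Monotonicity from `u` to `v`, where `h` is constant, then bounds the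
  -- prefix sum of `v` by that of `u`.
  have hanti' : Antitone (h - (h p - h q) • firstSum n j) := by
    intro a b hab
    have h3 := hanti hab
    simp only [Pi.sub_apply, Pi.smul_apply, firstSum, smul_eq_mul]
    rw [Fin.le_def] at hab
    split_ifs with hb ha ha
    · linarith
    · omega
    · have h4 : h p ≤ h a := hanti (by rw [Fin.le_def]; omega)
      have h5 : h b ≤ h q := hanti (by rw [Fin.le_def]; omega)
      linarith
    · linarith
  have hjv : prefixSum j v = prefixSum j u := by
    have h3 := huv.dotProduct_le hanti'
    simp only [sub_dotProduct, smul_dotProduct, firstSum_dotProduct_permPoint, smul_eq_mul, huc,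
      hvc] at h3
    have h4 : (h p - h q) * (prefixSum j v : ℝ) ≤ (h p - h q) * prefixSum j u := by linarith
    have h5 : (prefixSum j v : ℝ) ≤ prefixSum j u := le_of_mul_le_mul_left h4 (by linarith)
    exact le_antisymm (by exact_mod_cast h5) (huv.prefixSum_le j).1
  have hlev : ∀ x ∈ convexHull ℝ (permPoint '' {z : Perm (Fin n) | h ⬝ᵥ permPoint z = c}),
      firstSum n j ⬝ᵥ x = prefixSum j u := by
    intro x hx
    have : ∀ y ∈ permPoint '' {z : Perm (Fin n) | h ⬝ᵥ permPoint z = c},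
        dotFunctional (firstSum n j) y = prefixSum j u := by
      rintro _ ⟨z, hz, rfl⟩
      rw [dotFunctional_apply, firstSum_dotProduct_permPoint]
      have h3 := (((hu z).1 (ge_of_eq hz)).prefixSum_le j).1
      have h4 := (((hv z).1 (le_of_eq hz)).prefixSum_le j).1
      rw [hjv] at h4
      rw [le_antisymm h4 h3]
    rw [← dotFunctional_apply]
    exact le_antisymm (le_of_mem_convexHull (fun y hy => (this y hy).le) hx)
      (ge_of_mem_convexHull (fun y hy => (this y hy).ge) hx)
  -- The segment from `z` to `y` crosses `h = c` at a point where the prefix sum is that of `u`, so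
  -- both functionals divide it in the same ratio.
  have hrel : ∀ z y : Perm (Fin n), h ⬝ᵥ permPoint z < c → c < h ⬝ᵥ permPoint y →
      (h ⬝ᵥ permPoint y - c) * (prefixSum j z - prefixSum j u : ℝ) =
        (h ⬝ᵥ permPoint z - c) * (prefixSum j y - prefixSum j u) := by
    intro z y hz hy
    have h3 := hlev _ (hcross z y hz hy)
    have hpos : h ⬝ᵥ permPoint y - h ⬝ᵥ permPoint z ≠ 0 := by
      have : 0 < h ⬝ᵥ permPoint y - h ⬝ᵥ permPoint z := by linarith
      exact this.ne'
    rw [dotProduct_add, dotProduct_smul, dotProduct_smul, smul_eq_mul, smul_eq_mul,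
      firstSum_dotProduct_permPoint, firstSum_dotProduct_permPoint] at h3
    field_simp at h3
    linarith
  obtain ⟨r, hr⟩ : ∃ r : ℝ, ∀ z : Perm (Fin n),
      (prefixSum j z - prefixSum j u : ℝ) = r * (h ⬝ᵥ permPoint z - c) := by
    refine ⟨(prefixSum j (revPerm n) - prefixSum j u) / (h ⬝ᵥ permPoint (revPerm n) - c),
      fun z => ?_⟩
    have h3 : h ⬝ᵥ permPoint (revPerm n) - c ≠ 0 := (sub_pos.2 h2).ne'
    have h4 : h ⬝ᵥ permPoint (1 : Perm (Fin n)) - c ≠ 0 := (sub_neg.2 h1).ne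
    rw [div_mul_eq_mul_div, eq_div_iff h3]
    rcases lt_trichotomy (h ⬝ᵥ permPoint z) c with hz | hz | hz
    · linarith [hrel z _ hz h2]
    · have h5 := hlev _ (subset_convexHull ℝ _ ⟨z, hz, rfl⟩)
      rw [firstSum_dotProduct_permPoint] at h5
      rw [hz, h5]
      ring
    · have h5 := hrel _ z h1 hz
      have h6 := hrel _ _ h1 h2
      refine mul_left_cancel₀ h4 ?_
      linear_combination (h ⬝ᵥ permPoint z - c) * h6 - (h ⬝ᵥ permPoint (revPerm n) - c) * h5
  -- Swapping `p` and `q` in the identity raises the prefix sum by `1` and `h` by the drop, so `r *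
  -- (h p - h q) = 1`.
  have hrpos : 0 < r := by
    have h3 := hr 1
    have h4 := hr (1 * swap p q)
    rw [dotProduct_permPoint_mul_swap, prefixSum_mul_swap] at h4
    simp only [firstSum, if_pos hpj, if_neg hj.le.not_gt, Perm.coe_one, id] at h4
    have h5 : (q.val : ℝ) - p.val = 1 := by rw [← hpq]; push_cast; ring
    rw [h5] at h4
    have h6 : r * (h p - h q) = 1 := by linarith
    by_contra h7
    nlinarith
  have hiff : ∀ z, (h ⬝ᵥ permPoint z ≤ c ↔ prefixSum j z ≤ prefixSum j u) ∧
      (c ≤ h ⬝ᵥ permPoint z ↔ prefixSum j u ≤ prefixSum j z) := by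
    intro z
    have h3 := hr z
    constructor
    · rw [← Nat.cast_le (α := ℝ), ← sub_nonpos, ← sub_nonpos (a := (prefixSum j z : ℝ)), h3,
        mul_nonpos_iff_pos_imp_nonpos]
      constructor
      · intro h4; exact ⟨fun _ => h4, fun _ => hrpos.le⟩
      · intro h4; exact h4.1 hrpos
    · rw [← Nat.cast_le (α := ℝ), ← sub_nonneg, ← sub_nonneg (a := (prefixSum j z : ℝ)), h3,
        mul_nonneg_iff_of_pos_left hrpos]
  have hq := q.isLt
  refine ⟨j, by omega, by omega, ?_, hiff⟩
  have huniq : ∀ z, prefixSum j z = prefixSum j u → prefixImage j u = prefixImage j z :=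
    fun z hz => (((hu z).1 ((hiff z).2.2 hz.ge)).prefixSum_le j).2 hz.symm
  intro y z hy hz
  rw [← huniq y hy, ← huniq z hz]

/-- If the two cells of a split of the permutahedron are Bruhat interval polytopes and the first one
contains the identity, then the cells are cut out by a prefix sum with a unique prefix. -/
lemma IsSplit.exists_prefixSum {n : ℕ} {S : Set (Set (Fin n → ℝ))} {F₁ F₂ : Set (Fin n → ℝ)}
    (hs : IsSplit (permutahedron n) S F₁ F₂) (hB₁ : IsBruhatIntervalPolytope F₁)
    (hB₂ : IsBruhatIntervalPolytope F₂) (h1 : permPoint (1 : Perm (Fin n)) ∈ F₁) :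
    ∃ (j : ℕ) (u : Perm (Fin n)), 1 ≤ j ∧ j + 1 ≤ n ∧ PrefixUnique n j (prefixSum j u) ∧
      prefixSum j (1 : Perm (Fin n)) < prefixSum j u ∧
      prefixSum j u < prefixSum j (revPerm n) ∧
      F₁ = permutahedron n ∩ lowerHalf (firstSum n j) (prefixSum j u) ∧
      F₂ = permutahedron n ∩ upperHalf (firstSum n j) (prefixSum j u) := by
  obtain ⟨l, c, hl₁, hl₂, hlt, hgt⟩ := hs.exists_halfSpaces (convex_convexHull ℝ _)
  obtain ⟨h, hh⟩ := l.exists_eq_dotProduct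
  simp only [hh] at hl₁ hl₂ hlt hgt
  obtain ⟨u₁, v₁, -, hF₁⟩ := hB₁
  obtain ⟨u₂, v₂, -, hF₂⟩ := hB₂
  have hm₁ : ∀ z, h ⬝ᵥ permPoint z ≤ c ↔ BruhatLE u₁ z ∧ BruhatLE z v₁ := fun z => by
    have h3 : permPoint z ∈ F₁ ↔ h ⬝ᵥ permPoint z ≤ c := by
      rw [hl₁]; exact and_iff_right (permPoint_mem_permutahedron z)
    rw [← h3, hF₁, permPoint_mem_convexHull_iff]
    rfl
  have hm₂ : ∀ z, c ≤ h ⬝ᵥ permPoint z ↔ BruhatLE u₂ z ∧ BruhatLE z v₂ := fun z => by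
    have h3 : permPoint z ∈ F₂ ↔ c ≤ h ⬝ᵥ permPoint z := by
      rw [hl₂]; exact and_iff_right (permPoint_mem_permutahedron z)
    rw [← h3, hF₂, permPoint_mem_convexHull_iff]
    rfl
  have hlt' : ∃ z : Perm (Fin n), h ⬝ᵥ permPoint z < c := by
    by_contra! hc
    obtain ⟨x, hx, hxc⟩ := hlt
    have := ge_of_mem_convexHull (l := dotFunctional h) (c := c) (by
      rintro _ ⟨z, rfl⟩
      rw [dotFunctional_apply]
      exact hc z) hx
    rw [dotFunctional_apply] at this
    linarith
  have hgt' : ∃ z : Perm (Fin n), c < h ⬝ᵥ permPoint z := by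
    by_contra! hc
    obtain ⟨x, hx, hxc⟩ := hgt
    have := le_of_mem_convexHull (l := dotFunctional h) (c := c) (by
      rintro _ ⟨z, rfl⟩
      rw [dotFunctional_apply]
      exact hc z) hx
    rw [dotFunctional_apply] at this
    linarith
  have hu₁ : u₁ = 1 := by
    rw [hF₁, permPoint_mem_convexHull_iff] at h1
    exact h1.1.eq_one
  subst hu₁
  obtain ⟨y, hy⟩ := hgt'
  obtain ⟨x, hx⟩ := hlt'
  -- Otherwise the longest element lies in the first interval, which is then the whole group,
  -- although some permutation lies strictly above the level.
  have hw : c < h ⬝ᵥ permPoint (revPerm n) := by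
    by_contra hcon
    have h3 := ((hm₁ _).1 (not_lt.1 hcon)).2.eq_revPerm
    subst h3
    exact absurd hy (not_lt.2 ((hm₁ y).2 ⟨one_bruhatLE y, bruhatLE_revPerm y⟩))
  have hv₂ : v₂ = revPerm n := ((hm₂ _).1 hw.le).2.eq_revPerm
  subst hv₂
  have he : h ⬝ᵥ permPoint (1 : Perm (Fin n)) < c := by
    by_contra hcon
    have h3 := ((hm₂ _).1 (not_lt.1 hcon)).1.eq_one
    subst h3
    exact absurd hx (not_lt.2 ((hm₂ x).2 ⟨one_bruhatLE x, bruhatLE_revPerm x⟩))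
  have hconv : ∀ x ∈ permutahedron n, h ⬝ᵥ x = c →
      x ∈ convexHull ℝ (permPoint '' {z : Perm (Fin n) | h ⬝ᵥ permPoint z = c}) := by
    intro x hx hxc
    have hx₁ : x ∈ F₁ := by rw [hl₁]; exact ⟨hx, hxc.le⟩
    rw [hF₁] at hx₁
    -- The first cell is spanned by permutations with `h ≤ c`, so its points on the level are
    -- spanned by the permutations on the level.
    refine convexHull_mono ?_ (mem_convexHull_level (l := dotFunctional h) (c := c) ?_ hx₁ ?_)
    · rintro _ ⟨⟨z, -, rfl⟩, hz⟩
      rw [dotFunctional_apply] at hz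
      exact ⟨z, hz, rfl⟩
    · rintro _ ⟨z, hz, rfl⟩
      rw [dotFunctional_apply]
      exact (hm₁ z).2 hz
    · rw [dotFunctional_apply, hxc]
  obtain ⟨j, hj1, hjn, huniq, hiff⟩ := exists_prefixSum_of_intervals (u := u₂) (v := v₁)
    (fun z => (hm₁ z).trans (and_iff_right (one_bruhatLE z)))
    (fun z => (hm₂ z).trans (and_iff_left (bruhatLE_revPerm z))) he hw hconv
  refine ⟨j, u₂, hj1, hjn, huniq, ?_, ?_, ?_, ?_⟩
  · exact not_le.1 (mt (hiff 1).2.2 (not_le.2 he))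
  · exact not_le.1 (mt (hiff _).1.2 (not_le.2 hw))
  · rw [permutahedron_inter_lowerHalf, hF₁]
    congr 2
    ext z
    exact (hm₁ z).symm.trans (hiff z).1
  · rw [permutahedron_inter_upperHalf, hF₂]
    congr 2
    ext z
    exact (hm₂ z).symm.trans (hiff z).2

lemma IsSplit.symm {n : ℕ} {P : Set (Fin n → ℝ)} {S : Set (Set (Fin n → ℝ))}
    {F₁ F₂ : Set (Fin n → ℝ)} (h : IsSplit P S F₁ F₂) : IsSplit P S F₂ F₁ :=
  ⟨h.subdivision, h.ne.symm, fun F => (h.maximal_iff F).trans or_comm⟩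

lemma IsSplit.exists_isHyperplaneSplit {n : ℕ} {S : Set (Set (Fin n → ℝ))}
    {F₁ F₂ : Set (Fin n → ℝ)}
    (hs : IsSplit (permutahedron n) S F₁ F₂) (hB₁ : IsBruhatIntervalPolytope F₁)
    (hB₂ : IsBruhatIntervalPolytope F₂) :
    ∃ (j : ℕ) (u : Perm (Fin n)), 1 ≤ j ∧ j + 1 ≤ n ∧ PrefixUnique n j (prefixSum j u) ∧
      prefixSum j (1 : Perm (Fin n)) < prefixSum j u ∧
      prefixSum j u < prefixSum j (revPerm n) ∧
      IsHyperplaneSplit (permutahedron n) (firstSum n j) (prefixSum j u) S F₁ F₂ := by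
  have h1 : permPoint (1 : Perm (Fin n)) ∈ F₁ ∨ permPoint (1 : Perm (Fin n)) ∈ F₂ := by
    have h2 := permPoint_mem_permutahedron (1 : Perm (Fin n))
    obtain ⟨l, c, hl₁, hl₂, -⟩ := hs.exists_halfSpaces (convex_convexHull ℝ _)
    rw [hl₁, hl₂]
    exact (le_total _ _).imp (fun h => ⟨h2, h⟩) fun h => ⟨h2, h⟩
  rcases h1 with h1 | h1
  · obtain ⟨j, u, hj1, hjn, huniq, hlt, hgt, hF₁, hF₂⟩ := hs.exists_prefixSum hB₁ hB₂ h1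
    exact ⟨j, u, hj1, hjn, huniq, hlt, hgt, isHyperplaneSplit_of_isSplit hs (Or.inl ⟨hF₁, hF₂⟩) rfl⟩
  · obtain ⟨j, u, hj1, hjn, huniq, hlt, hgt, hF₂, hF₁⟩ := hs.symm.exists_prefixSum hB₂ hB₁ h1
    exact ⟨j, u, hj1, hjn, huniq, hlt, hgt, isHyperplaneSplit_of_isSplit hs (Or.inr ⟨hF₁, hF₂⟩) rfl⟩

/-! ### The three types of hyperplanes -/

/-- On the permutahedron the coordinate sum is constant, so `x_n = r` and a level of `x_1 + ⋯ +
x_{n-1}` cut out the same hyperplane with the sides exchanged. -/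
lemma IsHyperplaneSplit.of_neg {n : ℕ} {P : Set (Fin n → ℝ)} {a a' : Fin n → ℝ} {b b' : ℝ}
    {S : Set (Set (Fin n → ℝ))} {F₁ F₂ : Set (Fin n → ℝ)} (h : IsHyperplaneSplit P a b S F₁ F₂)
    (ha : ∀ x ∈ affineSpan ℝ P, a' ⬝ᵥ x + a ⬝ᵥ x = b' + b) :
    IsHyperplaneSplit P a' b' S F₁ F₂ := by
  have hP : ∀ x ∈ P, a' ⬝ᵥ x + a ⬝ᵥ x = b' + b := fun x hx => ha x (subset_affineSpan ℝ P hx)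
  have hl : P ∩ lowerHalf a b = P ∩ upperHalf a' b' := by
    ext x
    refine and_congr_right fun hx => ?_
    rw [mem_lowerHalf, mem_upperHalf]
    have := hP x hx
    constructor <;> intro <;> linarith
  have hr : P ∩ upperHalf a b = P ∩ lowerHalf a' b' := by
    ext x
    refine and_congr_right fun hx => ?_
    rw [mem_lowerHalf, mem_upperHalf]
    have := hP x hx
    constructor <;> intro <;> linarith
  refine ⟨h.split, ?_, ?_⟩
  · rw [h.span_inter]
    ext x
    refine and_congr_right fun hx => ?_
    rw [mem_hyperplane, mem_hyperplane]
    have := ha x hx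
    constructor <;> intro <;> linarith
  · rw [← hl, ← hr]
    exact h.cells.symm

lemma single_add_firstSum {n j : ℕ} {i : Fin n} (hi : i.val + 1 = n) (hj : j + 1 = n) {b r : ℕ}
    (hbr : b + r = ∑ k : Fin n, (k.val + 1)) :
    ∀ x ∈ affineSpan ℝ (permutahedron n),
      Pi.single i 1 ⬝ᵥ x + firstSum n j ⬝ᵥ x = (r : ℝ) + b := by
  intro x hx
  rw [mem_affineSpan_permutahedron] at hx
  have h1 : (Pi.single i 1 : Fin n → ℝ) + firstSum n j = 1 := by
    ext k
    have := k.isLt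
    by_cases hk : k = i
    · subst hk
      simp [firstSum, show ¬ k.val < j by omega]
    · have : k.val ≠ i.val := fun h => hk (Fin.ext h)
      simp [firstSum, hk, show k.val < j by omega]
  rw [← add_dotProduct, h1, one_dotProduct, hx, add_comm (r : ℝ)]
  exact_mod_cast hbr.symm

lemma firstSum_one {n : ℕ} {i : Fin n} (hi : i.val = 0) : firstSum n 1 = Pi.single i 1 := by
  ext k
  by_cases hk : k = i
  · subst hk
    simp [firstSum, hi]
  · have : k.val ≠ i.val := fun h => hk (Fin.ext h)
    simp [firstSum, hk, show ¬ k.val < 1 by omega]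

lemma sum_ite_val_lt {n j : ℕ} (hj : j ≤ n) (f : ℕ → ℕ) :
    ∑ i : Fin n, (if i.val < j then f i.val else 0) = ∑ i ∈ range j, f i := by
  rw [Fin.sum_univ_eq_sum_range (fun i => if i < j then f i else 0), ← sum_filter]
  congr 1
  ext i
  simp only [mem_filter, mem_range]
  omega

lemma prefixSum_one {n j : ℕ} (hj : j ≤ n) :
    prefixSum j (1 : Perm (Fin n)) = (j + 1).choose 2 := by
  rw [prefixSum]
  refine (sum_ite_val_lt hj fun i => i + 1).trans ?_
  clear hj
  induction j with
  | zero => rfl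
  | succ j ih =>
    rw [sum_range_succ, ih, Nat.choose_succ_succ' (j + 1), Nat.choose_one_right, add_comm]

lemma prefixSum_revPerm {n j : ℕ} (hj : j ≤ n) :
    prefixSum j (revPerm n) = ∑ k ∈ range j, (n - k) := by
  rw [prefixSum, ← sum_ite_val_lt hj]
  refine sum_congr rfl fun i _ => ?_
  have h : (revPerm n i).val = n - (i.val + 1) := Fin.val_rev i
  have := i.isLt
  split_ifs <;> omega

lemma prefixSum_revPerm_sub_one {n j : ℕ} (hj1 : 1 ≤ j) (hj : j ≤ n) :
    (∑ k ∈ range (j - 1), ((n : ℝ) - k)) + ((n : ℝ) - j) = prefixSum j (revPerm n) - 1 := by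
  obtain ⟨m, rfl⟩ := Nat.exists_eq_add_of_le' hj1
  rw [prefixSum_revPerm hj, sum_range_succ, add_tsub_cancel_right]
  push_cast
  rw [Nat.cast_sub (by omega), sum_congr rfl fun k hk => Nat.cast_sub (R := ℝ)
    (show k ≤ n by have := mem_range.1 hk; omega)]
  ring

/-- The prefix sums range over an interval of length `j * (n - j)`, which is at least `2` here; this
keeps the levels of (T1) and (T2) strictly inside. -/
lemma prefixSum_one_add_one_lt {n j : ℕ} (hj1 : 1 ≤ j) (hj : j + 2 ≤ n) :
    prefixSum j (1 : Perm (Fin n)) + 1 < prefixSum j (revPerm n) := by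
  have h1 := prefixSum_revPerm_mul j (1 : Perm (Fin n))
  rw [mul_one, Fin.card_filter_val_lt, min_eq_right (by omega)] at h1
  have h2 := prefixSum_one (n := n) (j := j) (by omega)
  rw [Nat.choose_two_right, add_tsub_cancel_right] at h2
  have h3 := Nat.div_mul_le_self ((j + 1) * j) 2
  rw [← h2] at h3
  obtain ⟨d, rfl⟩ := Nat.exists_eq_add_of_le hj
  have h4 : 1 < j * 2 + j * d := by omega
  have h5 : j * (j + 2 + d + 1) = (j + 1) * j + (j * 2 + j * d) := by ring
  omega

lemma isType_of_isHyperplaneSplit {n j b : ℕ} {S : Set (Set (Fin n → ℝ))}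
    {F₁ F₂ : Set (Fin n → ℝ)} (hs : IsHyperplaneSplit (permutahedron n) (firstSum n j) b S F₁ F₂)
    (h : PrefixUnique n j b) {u : Perm (Fin n)} (hu : prefixSum j u = b) (hj1 : 1 ≤ j)
    (hjn : j + 1 ≤ n) (h1 : prefixSum j (1 : Perm (Fin n)) < b)
    (h2 : b < prefixSum j (revPerm n)) :
    ∃ (a : Fin n → ℝ) (b : ℝ), (IsTypeT1 n a b ∨ IsTypeT2 n a b ∨ IsTypeT3 n a b) ∧
      IsHyperplaneSplit (permutahedron n) a b S F₁ F₂ := by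
  -- The cases `j = n - 1` and `j = 1` are type (T3) at every level, so the classification is needed
  -- only for the remaining `j`.
  rcases Nat.eq_or_lt_of_le hjn with hn | hn
  · have hi : (⟨j, by omega⟩ : Fin n).val + 1 = n := hn
    have e1 := prefixSum_last (1 : Perm (Fin n)) _ hi hn
    have e2 := prefixSum_last u _ hi hn
    have e3 := prefixSum_last (revPerm n) _ hi hn
    have e4 : (revPerm n ⟨j, by omega⟩).val = n - (j + 1) := Fin.val_rev _
    have e5 : ((1 : Perm (Fin n)) ⟨j, by omega⟩).val = j := rfl
    refine ⟨_, _, Or.inr (Or.inr ⟨⟨j, by omega⟩, (u ⟨j, by omega⟩).val + 1, Or.inr hi, by omega,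
      by omega, rfl, rfl⟩), hs.of_neg (single_add_firstSum hi hn (by omega))⟩
  rcases Nat.eq_or_lt_of_le hj1 with rfl | hj2
  · have hi : (⟨0, by omega⟩ : Fin n).val = 0 := rfl
    have e1 := prefixSum_first (1 : Perm (Fin n)) _ hi
    have e3 := prefixSum_first (revPerm n) _ hi
    have e4 : (revPerm n ⟨0, by omega⟩).val = n - (0 + 1) := Fin.val_rev _
    have e5 : ((1 : Perm (Fin n)) ⟨0, by omega⟩).val = 0 := rfl
    exact ⟨_, _, Or.inr (Or.inr ⟨⟨0, by omega⟩, b, Or.inl hi, by omega, by omega,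
      firstSum_one hi, rfl⟩), hs⟩
  rcases h.classification hu (by omega) (by omega) h1 h2 with hc | hc | hc | hc
  · omega
  · omega
  · refine ⟨_, _, Or.inl ⟨j, hj1, hn, rfl, ?_⟩, hs⟩
    rw [hc, prefixSum_one (by omega)]
    push_cast
    rfl
  · refine ⟨_, _, Or.inr (Or.inl ⟨j, hj1, hn, rfl, ?_⟩), hs⟩
    rw [prefixSum_revPerm_sub_one hj1 (by omega), ← hc]
    push_cast
    ring

lemma exists_isHyperplaneSplit_of_isType {n : ℕ} {a : Fin n → ℝ} {b : ℝ}
    (h : IsTypeT1 n a b ∨ IsTypeT2 n a b ∨ IsTypeT3 n a b) :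
    ∃ (S : Set (Set (Fin n → ℝ))) (F₁ F₂ : Set (Fin n → ℝ)),
      IsHyperplaneSplit (permutahedron n) a b S F₁ F₂ ∧
        IsBruhatIntervalPolytope F₁ ∧ IsBruhatIntervalPolytope F₂ := by
  rcases h with ⟨j, hj1, hjn, rfl, rfl⟩ | ⟨j, hj1, hjn, rfl, rfl⟩ |
    ⟨i, r, hi | hi, hr1, hr2, rfl, rfl⟩
  · have h1 := prefixSum_one_add_one_lt hj1 hjn
    have h2 := (prefixUnique_min_add_one (n := n) (j := j)).exists_isHyperplaneSplit (by omega) h1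
    rw [prefixSum_one (by omega)] at h2
    push_cast at h2
    exact h2
  · have h1 := prefixSum_one_add_one_lt hj1 hjn
    obtain ⟨b, hb⟩ : ∃ b, b + 1 = prefixSum j (revPerm n) := ⟨_, Nat.sub_add_cancel (by omega)⟩
    have h2 := (prefixUnique_max_sub_one hb).exists_isHyperplaneSplit (by omega) (by omega)
    rw [prefixSum_revPerm_sub_one hj1 (by omega), ← hb]
    push_cast
    rwa [add_sub_cancel_right]
  · have e1 := prefixSum_first (1 : Perm (Fin n)) i hi
    have e3 := prefixSum_first (revPerm n) i hi
    have e4 : (revPerm n i).val = n - (i.val + 1) := Fin.val_rev _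
    have e5 : ((1 : Perm (Fin n)) i).val = i.val := rfl
    rw [← firstSum_one hi]
    exact (prefixUnique_one n r).exists_isHyperplaneSplit (by omega) (by omega)
  · obtain ⟨j, hj⟩ : ∃ j, j + 1 = n := ⟨_, hi⟩
    have e1 := prefixSum_last (1 : Perm (Fin n)) i hi hj
    have e3 := prefixSum_last (revPerm n) i hi hj
    have e4 : (revPerm n i).val = n - (i.val + 1) := Fin.val_rev _
    have e5 : ((1 : Perm (Fin n)) i).val = i.val := rfl
    obtain ⟨b, hb⟩ : ∃ b, b + r = ∑ k : Fin n, (k.val + 1) := ⟨_, Nat.sub_add_cancel (by omega)⟩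
    obtain ⟨S, F₁, F₂, hs, hB⟩ :=
      (prefixUnique_of_add_one_eq hj b).exists_isHyperplaneSplit (by omega) (by omega)
    exact ⟨S, F₁, F₂, hs.of_neg (single_add_firstSum hi hj hb), hB⟩

/-- Every split of `Π_n` into Bruhat interval polytopes is the `H`-split for a hyperplane `H` of type
(T1), (T2) or (T3), and conversely every hyperplane of one of these types gives such a split. -/
theorem theorem3p10 (n : ℕ) :
    (∀ (S : Set (Set (Fin n → ℝ))) (F₁ F₂ : Set (Fin n → ℝ)),
      IsSplit (permutahedron n) S F₁ F₂ →
      IsBruhatIntervalPolytope F₁ → IsBruhatIntervalPolytope F₂ →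
      ∃ (a : Fin n → ℝ) (b : ℝ), (IsTypeT1 n a b ∨ IsTypeT2 n a b ∨ IsTypeT3 n a b) ∧
        IsHyperplaneSplit (permutahedron n) a b S F₁ F₂) ∧
    (∀ (a : Fin n → ℝ) (b : ℝ), (IsTypeT1 n a b ∨ IsTypeT2 n a b ∨ IsTypeT3 n a b) →
      ∃ (S : Set (Set (Fin n → ℝ))) (F₁ F₂ : Set (Fin n → ℝ)),
        IsHyperplaneSplit (permutahedron n) a b S F₁ F₂ ∧
        IsBruhatIntervalPolytope F₁ ∧ IsBruhatIntervalPolytope F₂) := by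
  refine ⟨fun S F₁ F₂ hs hB₁ hB₂ => ?_, fun a b h => exists_isHyperplaneSplit_of_isType h⟩
  obtain ⟨j, u, hj1, hjn, huniq, h1, h2, hsplit⟩ := hs.exists_isHyperplaneSplit hB₁ hB₂
  exact isType_of_isHyperplaneSplit hsplit huniq rfl hj1 hjn h1 h2
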